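/- **Proposition 4.1.** Let $(M^n,g)$ be a smooth Riemannian manifold (Hausdorff, second countable, without boundary), let $f:M\to\mathbb R$ be a smooth function and let $V$ be a smooth vector field on $M$ such that $$2\,\mathrm{Ric}(g)+g-\mathcal L_{\nabla f}(g)=\mathcal L_V(g).$$ Write $\Delta_f V:=\Delta V+\nabla_{\nabla f}V$, where $\Delta V=\operatorname{tr}_g\nabla^2V$ is the rough Laplacian, $\operatorname{div}_fV:=\operatorname{div}V+\langle\nabla f,V\rangle$, $\mathrm{Ric}_f(g):=\mathrm{Ric}(g)-\nabla^{2}f$ (the Bakry–Émery tensor), $\mathrm{Ric}_f(g)(V)$ for the vector field metrically dual to the $1$-form $\mathrm{Ric}_f(g)(V,\cdot)$, and $\mathrm R_g$ for the scalar curvature. Then $$\Delta_f V+\mathrm{Ric}_f(g)(V)+\nabla(\operatorname{div}_fV)=\nabla\big(\mathrm R_g+f-2\Delta f-|\nabla f|^2\big)\quad\text{on }M.$$ In particular, suppose that $V\to0$ at infinity (for every $\varepsilon>0$ there is a compact set outside of which $|V|<\varepsilon$), that $\mathrm{Ric}_f(g)$ is negative definite at every point of $M$, and that - either $\mathrm R_g+f-2\Delta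 f-|\nabla f|^2$ is constant on $M$ and $\operatorname{div}_fV=0$ on $M$, - or $\mathrm R_g+f-2\Delta f-|\nabla f|^2-\operatorname{div}_fV$ is constant on $M$. Then $V\equiv0$. -/

import Mathlib

open Bundle Manifold ContDiff Topology Filter FiberBundle

namespace RiemGeom

/-- The endomorphism `A` of an inner product space with `⟨A v, w⟩ = B v w`. -/
noncomputable def endoOfBilin {F : Type*} [NormedAddCommGroup F] [InnerProductSpace ℝ F]
    [FiniteDimensional ℝ F] [CompleteSpace F] (B : F →L[ℝ] F →L[ℝ] ℝ) : F →L[ℝ] F :=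
  LinearMap.toContinuousLinearMap
    { toFun := fun v ↦ (InnerProductSpace.toDual ℝ F).symm (B v)
      map_add' := fun u v ↦ by rw [map_add, map_add]
      map_smul' := fun c u ↦ by rw [map_smul, map_smulₛₗ]; simp }

theorem inner_endoOfBilin {F : Type*} [NormedAddCommGroup F] [InnerProductSpace ℝ F]
    [FiniteDimensional ℝ F] [CompleteSpace F] (B : F →L[ℝ] F →L[ℝ] ℝ) (v w : F) :
    inner ℝ (endoOfBilin B v) w = B v w := by
  simp [endoOfBilin]

section LeviCivita

variable {E : Type*} [NormedAddCommGroup E] [NormedSpace ℝ E] [FiniteDimensional ℝ E]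
  {H : Type*} [TopologicalSpace H] {I : ModelWithCorners ℝ E H}
  {M : Type*} [TopologicalSpace M] [ChartedSpace H M] [IsManifold I ∞ M]

instance instFiniteDimensionalTangentSpace (x : M) : FiniteDimensional ℝ (TangentSpace I x) :=
  inferInstanceAs (FiniteDimensional ℝ E)

variable [RiemannianBundle (fun x : M ↦ TangentSpace I x)]

instance instCompleteSpaceTangentSpace (x : M) : CompleteSpace (TangentSpace I x) :=
  FiniteDimensional.complete ℝ (TangentSpace I x)

/-- The Koszul expression
`X⟨Y,Z⟩ + Y⟨X,Z⟩ - Z⟨X,Y⟩ + ⟨[X,Y],Z⟩ - ⟨[X,Z],Y⟩ - ⟨[Y,Z],X⟩` at the point `x`,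
which determines the Levi-Civita connection through `2⟨∇_X Y, Z⟩`. -/
noncomputable def koszul (X Y Z : Π x : M, TangentSpace I x) (x : M) : ℝ :=
  d% (fun y ↦ inner ℝ (Y y) (Z y)) x (X x) + d% (fun y ↦ inner ℝ (X y) (Z y)) x (Y x)
    - d% (fun y ↦ inner ℝ (X y) (Y y)) x (Z x)
    + inner ℝ (VectorField.mlieBracket I X Y x) (Z x)
    - inner ℝ (VectorField.mlieBracket I X Z x) (Y x)
    - inner ℝ (VectorField.mlieBracket I Y Z x) (X x)

variable [IsContMDiffRiemannianBundle I ∞ E (fun x : M ↦ TangentSpace I x)]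

set_option linter.unusedSectionVars false in
/-- The inner product of two differentiable vector fields is differentiable. -/
theorem mdifferentiableAt_inner {x : M} {X Y : Π x : M, TangentSpace I x}
    (hX : MDiffAt (T% X) x) (hY : MDiffAt (T% Y) x) :
    MDiffAt (fun y ↦ inner ℝ (X y) (Y y)) x :=
  MDifferentiableAt.inner_bundle (IB := I) (F := E) (E := fun x : M ↦ TangentSpace I x)
    (b := fun y ↦ y) (v := X) (w := Y) hX hY

theorem koszul_tensorial_left {x : M} {Y Z : Π x : M, TangentSpace I x}
    (hY : MDiffAt (T% Y) x) (hZ : MDiffAt (T% Z) x) :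
    TensorialAt I E (fun X ↦ koszul X Y Z x) x where
  smul {f X} hf hX := by
    have h1 := mvfderiv_fun_mul hf (mdifferentiableAt_inner hX hZ)
    have h2 := mvfderiv_fun_mul hf (mdifferentiableAt_inner hX hY)
    simp [koszul, VectorField.mlieBracket_smul_left hf hX, inner_add_left, inner_smul_left, h1, h2,
      inner_smul_right]
    ring
  add {X X'} hX hX' := by
    have h1 := mvfderiv_fun_add (mdifferentiableAt_inner hX hZ) (mdifferentiableAt_inner hX' hZ)
    have h2 := mvfderiv_fun_add (mdifferentiableAt_inner hX hY) (mdifferentiableAt_inner hX' hY)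
    simp [koszul, VectorField.mlieBracket_add_left hX hX', inner_add_left, h1, h2,
      inner_add_right]
    ring

theorem koszul_tensorial_right {x : M} {X Y : Π x : M, TangentSpace I x}
    (hX : MDiffAt (T% X) x) (hY : MDiffAt (T% Y) x) :
    TensorialAt I E (fun Z ↦ koszul X Y Z x) x where
  smul {f Z} hf hZ := by
    have h1 := mvfderiv_fun_mul hf (mdifferentiableAt_inner hX hZ)
    have h2 := mvfderiv_fun_mul hf (mdifferentiableAt_inner hY hZ)
    simp [koszul, VectorField.mlieBracket_smul_right hf hZ, inner_add_left, inner_smul_left, h1, h2,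
      inner_smul_right, real_inner_comm (Z x)]
    ring
  add {Z Z'} hZ hZ' := by
    have h1 := mvfderiv_fun_add (mdifferentiableAt_inner hX hZ) (mdifferentiableAt_inner hX hZ')
    have h2 := mvfderiv_fun_add (mdifferentiableAt_inner hY hZ) (mdifferentiableAt_inner hY hZ')
    simp [koszul, VectorField.mlieBracket_add_right hZ hZ', inner_add_left, h1, h2,
      inner_add_right]
    ring

theorem koszul_add_middle {x : M} {X Y Y' Z : Π x : M, TangentSpace I x}
    (hX : MDiffAt (T% X) x) (hY : MDiffAt (T% Y) x) (hY' : MDiffAt (T% Y') x)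
    (hZ : MDiffAt (T% Z) x) :
    koszul X (Y + Y') Z x = koszul X Y Z x + koszul X Y' Z x := by
  have h1 := mvfderiv_fun_add (mdifferentiableAt_inner hY hZ) (mdifferentiableAt_inner hY' hZ)
  have h2 := mvfderiv_fun_add (mdifferentiableAt_inner hX hY) (mdifferentiableAt_inner hX hY')
  simp [koszul, VectorField.mlieBracket_add_right hY hY',
    VectorField.mlieBracket_add_left hY hY', inner_add_left, h1, h2, inner_add_right]
  ring

theorem koszul_smul_middle {x : M} {X Y Z : Π x : M, TangentSpace I x} {f : M → ℝ}
    (hX : MDiffAt (T% X) x) (hY : MDiffAt (T% Y) x) (hZ : MDiffAt (T% Z) x)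
    (hf : MDiffAt f x) :
    koszul X (f • Y) Z x
      = f x * koszul X Y Z x + 2 * (d% f x (X x) * inner ℝ (Y x) (Z x)) := by
  have h1 := mvfderiv_fun_mul hf (mdifferentiableAt_inner hY hZ)
  have h2 := mvfderiv_fun_mul hf (mdifferentiableAt_inner hX hY)
  simp [koszul, VectorField.mlieBracket_smul_right hf hY,
    VectorField.mlieBracket_smul_left hf hY, inner_add_left, h1, h2, inner_smul_left,
    inner_smul_right]
  rw [real_inner_comm (X x) (Y x)]
  ring

open scoped Classical in
/-- The covariant derivative `X₀ ↦ ∇_{X₀} Y` at `x` of the Levi-Civita connection: the metric dual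
of one half of the Koszul expression (and `0` by convention if `Y` is not differentiable
at `x`). -/
noncomputable def leviCivitaAux (Y : Π x : M, TangentSpace I x) (x : M) :
    TangentSpace I x →L[ℝ] TangentSpace I x :=
  if hY : MDiffAt (T% Y) x then
    endoOfBilin ((1 / 2 : ℝ) • TensorialAt.mkHom₂ (fun X Z ↦ koszul X Y Z x) x
      (fun _ hZ ↦ koszul_tensorial_left hY hZ) (fun _ hX ↦ koszul_tensorial_right hX hY))
  else 0

/-- The defining property of the Levi-Civita connection (Koszul formula). -/
theorem two_mul_inner_leviCivitaAux {x : M} {X Y Z : Π x : M, TangentSpace I x}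
    (hX : MDiffAt (T% X) x) (hY : MDiffAt (T% Y) x) (hZ : MDiffAt (T% Z) x) :
    2 * inner ℝ (leviCivitaAux Y x (X x)) (Z x) = koszul X Y Z x := by
  have h := TensorialAt.mkHom₂_apply (Φ := fun X Z ↦ koszul X Y Z x)
    (fun _ hZ ↦ koszul_tensorial_left hY hZ) (fun _ hX ↦ koszul_tensorial_right hX hY) hX hZ
  rw [← h]
  simp only [leviCivitaAux, hY, dif_pos, inner_endoOfBilin]
  simp


/-- The Levi-Civita connection of the Riemannian metric, as a covariant derivative on `TM`;
`leviCivita Y x (X x)` is `∇_X Y` at `x`. -/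
noncomputable def leviCivita : CovariantDerivative I E (fun x : M ↦ TangentSpace I x) where
  toFun := leviCivitaAux
  isCovariantDerivativeOnUniv :=
    { add := by
        intro Y Y' x hY hY' _
        ext1 u
        refine ext_inner_right ℝ fun w ↦ ?_
        have hu := mdifferentiableAt_extend I E u
        have hw := mdifferentiableAt_extend I E w
        have hs := mdifferentiableAt_add_section hY hY'
        have h := two_mul_inner_leviCivitaAux hu hs hw
        have h1 := two_mul_inner_leviCivitaAux hu hY hw
        have h2 := two_mul_inner_leviCivitaAux hu hY' hw
        rw [koszul_add_middle hu hY hY' hw, ← h1, ← h2] at h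
        simp only [extend_apply_self] at h
        simp only [add_apply, inner_add_left]
        linarith
      leibniz := by
        intro Y f x hY hf _
        ext1 u
        refine ext_inner_right ℝ fun w ↦ ?_
        have hu := mdifferentiableAt_extend I E u
        have hw := mdifferentiableAt_extend I E w
        have hs := hf.smul_section hY
        have h := two_mul_inner_leviCivitaAux hu hs hw
        have h1 := two_mul_inner_leviCivitaAux hu hY hw
        rw [koszul_smul_middle hu hY hw hf, ← h1] at h
        simp only [extend_apply_self] at h
        simp only [add_apply, inner_add_left,
          smul_apply, ContinuousLinearMap.smulRight_apply, inner_smul_left]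
        simp
        linarith }

/-- The Levi-Civita connection is torsion free: `∇_X Y - ∇_Y X = [X, Y]`. -/
theorem leviCivita_torsionFree {x : M} {X Y : Π x : M, TangentSpace I x}
    (hX : MDiffAt (T% X) x) (hY : MDiffAt (T% Y) x) :
    leviCivita Y x (X x) - leviCivita X x (Y x) = VectorField.mlieBracket I X Y x := by
  refine ext_inner_right ℝ fun w ↦ ?_
  have hw := mdifferentiableAt_extend I E w
  have h1 := two_mul_inner_leviCivitaAux hX hY hw
  have h2 := two_mul_inner_leviCivitaAux hY hX hw
  have h3 : (fun y ↦ inner ℝ (Y y) (X y)) = fun y ↦ (inner ℝ (X y) (Y y) : ℝ) :=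
    funext fun y ↦ real_inner_comm _ _
  have h4 : VectorField.mlieBracket I Y X x = -VectorField.mlieBracket I X Y x :=
    VectorField.mlieBracket_swap_apply
  simp only [koszul, h3, h4, inner_neg_left, extend_apply_self] at h1 h2
  rw [inner_sub_left]
  change inner ℝ (leviCivitaAux Y x (X x)) w - inner ℝ (leviCivitaAux X x (Y x)) w = _
  linarith

/-- The Levi-Civita connection is compatible with the metric:
`X⟨Y, Z⟩ = ⟨∇_X Y, Z⟩ + ⟨Y, ∇_X Z⟩`. -/
theorem leviCivita_metric {x : M} {Y Z : Π x : M, TangentSpace I x}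
    (hY : MDiffAt (T% Y) x) (hZ : MDiffAt (T% Z) x) (u : TangentSpace I x) :
    d% (fun y ↦ inner ℝ (Y y) (Z y)) x u
      = inner ℝ (leviCivita Y x u) (Z x) + inner ℝ (Y x) (leviCivita Z x u) := by
  have hu := mdifferentiableAt_extend I E u
  have h1 := two_mul_inner_leviCivitaAux hu hY hZ
  have h2 := two_mul_inner_leviCivitaAux hu hZ hY
  have h3 : (fun y ↦ inner ℝ (Z y) (Y y)) = fun y ↦ (inner ℝ (Y y) (Z y) : ℝ) :=
    funext fun y ↦ real_inner_comm _ _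
  have h4 : VectorField.mlieBracket I Z Y x = -VectorField.mlieBracket I Y Z x :=
    VectorField.mlieBracket_swap_apply
  simp only [koszul, h3, h4, inner_neg_left, extend_apply_self] at h1 h2
  rw [real_inner_comm (leviCivita Z x u)]
  change _ = inner ℝ (leviCivitaAux Y x u) (Z x) + inner ℝ (leviCivitaAux Z x u) (Y x)
  linarith

/-- The Lie derivative of the metric, `(L_X g)(u, w)` for `u, w` tangent at `x`, through
`(L_X g)(U, W) = X⟨U, W⟩ - ⟨[X, U], W⟩ - ⟨U, [X, W]⟩` for local extensions `U, W` of `u, w`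
(on which it does not depend, see `lieDerivMetric_apply`). -/
noncomputable def lieDerivMetric (X : Π x : M, TangentSpace I x) (x : M)
    (u w : TangentSpace I x) : ℝ :=
  d% (fun y ↦ inner ℝ ((extend E u : Π y : M, TangentSpace I y) y)
      ((extend E w : Π y : M, TangentSpace I y) y)) x (X x)
    - inner ℝ (VectorField.mlieBracket I X (extend E u) x) w
    - inner ℝ u (VectorField.mlieBracket I X (extend E w) x)

theorem lieDerivMetric_eq_leviCivita {x : M} {X : Π x : M, TangentSpace I x}
    (hX : MDiffAt (T% X) x) (u w : TangentSpace I x) :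
    lieDerivMetric X x u w
      = inner ℝ (leviCivita X x u) w + inner ℝ u (leviCivita X x w) := by
  have hu := mdifferentiableAt_extend I E u
  have hw := mdifferentiableAt_extend I E w
  rw [lieDerivMetric, leviCivita_metric hu hw, ← leviCivita_torsionFree hX hu,
    ← leviCivita_torsionFree hX hw]
  simp only [extend_apply_self, inner_sub_left, inner_sub_right]
  ring

theorem lieDerivMetric_apply {x : M} {X U W : Π x : M, TangentSpace I x}
    (hX : MDiffAt (T% X) x) (hU : MDiffAt (T% U) x) (hW : MDiffAt (T% W) x) :
    lieDerivMetric X x (U x) (W x) = d% (fun y ↦ inner ℝ (U y) (W y)) x (X x)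
      - inner ℝ (VectorField.mlieBracket I X U x) (W x)
      - inner ℝ (U x) (VectorField.mlieBracket I X W x) := by
  rw [lieDerivMetric_eq_leviCivita hX, leviCivita_metric hU hW, ← leviCivita_torsionFree hX hU,
    ← leviCivita_torsionFree hX hW]
  simp only [inner_sub_left, inner_sub_right]
  ring

variable (I) in
/-- The Riemannian gradient: `⟨∇f, w⟩ = df(w)`. -/
noncomputable def grad (f : M → ℝ) (x : M) : TangentSpace I x :=
  (InnerProductSpace.toDual ℝ (TangentSpace I x)).symm (d% f x)

/-- The divergence of a vector field, `div X = tr (v ↦ ∇_v X)`. -/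
noncomputable def divergence (X : Π x : M, TangentSpace I x) (x : M) : ℝ :=
  LinearMap.trace ℝ (TangentSpace I x) (leviCivita X x)

/-- The Hessian of a function, `∇²f(u, w) = ⟨∇_u ∇f, w⟩`. -/
noncomputable def hessian (f : M → ℝ) (x : M) (u w : TangentSpace I x) : ℝ :=
  inner ℝ (leviCivita (grad I f) x u) w

variable (I) in
/-- The Laplace-Beltrami operator on functions, `Δf = div ∇f = tr ∇²f`. -/
noncomputable def laplacian (f : M → ℝ) (x : M) : ℝ := divergence (grad I f) x

/-- The second covariant derivative `∇²_{u, w} Z = ∇_u ∇_W Z - ∇_{∇_u W} Z` of a vector field,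
where `W` is a local extension of `w`. -/
noncomputable def secondCovDeriv (Z : Π x : M, TangentSpace I x) (x : M)
    (u w : TangentSpace I x) : TangentSpace I x :=
  leviCivita (fun y ↦ leviCivita Z y (extend E w y)) x u
    - leviCivita Z x (leviCivita (extend E w) x u)

/-- The (rough) Laplacian of a vector field, `ΔV = tr ∇²V`, in an orthonormal basis of the tangent
space. -/
noncomputable def roughLaplacian (V : Π x : M, TangentSpace I x) (x : M) : TangentSpace I x :=
  ∑ i, secondCovDeriv V x (stdOrthonormalBasis ℝ (TangentSpace I x) i)
    (stdOrthonormalBasis ℝ (TangentSpace I x) i)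

/-- The curvature `R(u, v)w = ∇_U ∇_V W - ∇_V ∇_U W - ∇_{[U, V]} W` at `x`,
where `U, V, W` are local extensions of `u, v, w`. -/
noncomputable def curvature (x : M) (u v w : TangentSpace I x) : TangentSpace I x :=
  leviCivita (fun y ↦ leviCivita (extend E w) y (extend E v y)) x u
    - leviCivita (fun y ↦ leviCivita (extend E w) y (extend E u y)) x v
    - leviCivita (extend E w) x (VectorField.mlieBracket I (extend E u) (extend E v) x)

/-- The Ricci tensor `Ric(v, w) = tr (u ↦ R(u, v)w)`; it is positive on round spheres. -/
noncomputable def ricci (x : M) (v w : TangentSpace I x) : ℝ :=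
  ∑ i, inner ℝ (curvature x (stdOrthonormalBasis ℝ (TangentSpace I x) i) v w)
    (stdOrthonormalBasis ℝ (TangentSpace I x) i)

variable (I) in
/-- The scalar curvature, the trace of the Ricci tensor. -/
noncomputable def scalarCurvature (x : M) : ℝ :=
  ∑ i, ricci x (stdOrthonormalBasis ℝ (TangentSpace I x) i)
    (stdOrthonormalBasis ℝ (TangentSpace I x) i)

/-- The weighted divergence `div_f X = div X + ⟨∇f, X⟩`. -/
noncomputable def weightedDivergence (f : M → ℝ) (X : Π x : M, TangentSpace I x) (x : M) : ℝ :=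
  divergence X x + inner ℝ (grad I f x) (X x)

/-- The weighted Laplacian of a vector field, `Δ_f V = ΔV + ∇_{∇f} V`. -/
noncomputable def weightedLaplacian (f : M → ℝ) (V : Π x : M, TangentSpace I x) (x : M) :
    TangentSpace I x :=
  roughLaplacian V x + leviCivita V x (grad I f x)

/-- The Bakry-Emery tensor `Ric_f = Ric - ∇²f`. -/
noncomputable def bakryEmery (f : M → ℝ) (x : M) (v w : TangentSpace I x) : ℝ :=
  ricci x v w - hessian f x v w

/-- The vector `Ric_f(v)` which is metrically dual to `Ric_f(v, ·)`. -/
noncomputable def bakryEmeryVector (f : M → ℝ) (x : M) (v : TangentSpace I x) :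
    TangentSpace I x :=
  ∑ i, bakryEmery f x v (stdOrthonormalBasis ℝ (TangentSpace I x) i) •
    stdOrthonormalBasis ℝ (TangentSpace I x) i

end LeviCivita

end RiemGeom

/-!
Write `S = R + f - 2Δf - |∇f|²`. The identity is the divergence of the soliton equation. The
contracted Bianchi identity gives `div (2 Ric) = dR`, the metric is parallel, and commuting
covariant derivatives gives `div (L_V g) = ΔV + ∇ div V + Ric(V)` for every field `V`. For `V = ∇f`
the latter equals `2∇Δf + 2 Ric(∇f)` by the Bochner formula `Δ∇f = ∇Δf + Ric(∇f)`. Adding the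
soliton equation evaluated on `∇f` in one slot, which trades `2 Ric(∇f)` for first derivatives,
turns both sides into the weighted quantities of the statement. The lemmas are
`IsOrthonormalFrameAt.mvfderiv_scalarCurvature_eq_two_mul` (contracted Bianchi),
`IsOrthonormalFrameAt.sum_nablaForm_lieDerivMetric`,
`IsOrthonormalFrameAt.inner_roughLaplacian_grad` (Bochner) and
`weightedLaplacian_add_bakryEmeryVector_add_grad`.

In both alternatives of the second part `S - div_f V` is constant, so that `Δ_f V + Ric_f(V) = 0`.
If `V` were not zero, `|V|` would attain a positive maximum at some `p` because `V → 0` at infinity.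
There `½Δ_f|V|² = ⟨Δ_f V, V⟩ + |∇V|²` forces `⟨Δ_f V, V⟩ ≤ 0`
(`inner_weightedLaplacian_self_nonpos`), whereas `⟨Δ_f V, V⟩ = -Ric_f(V, V) > 0`.

Computations are made in vector fields rather than in coordinates. Near each point there is a smooth
orthonormal frame (Gram-Schmidt, `exists_isOrthonormalFrameAt`); traces are sums over this frame,
and the derivatives of the frame drop out of every trace since `⟨∇e_i, e_j⟩` is skew
(`IsOrthonormalFrameAt.sum_apply_nabla`). The pointwise definitions, which extend tangent vectors to
fields, are matched with the field expressions by tensoriality (`IsSmoothTensorialAt.congr`).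
-/

set_option linter.unusedSectionVars false

namespace RiemGeom

/-! ### Smooth orthonormal frames -/

section Smoothness

variable {E : Type*} [NormedAddCommGroup E] [NormedSpace ℝ E] [FiniteDimensional ℝ E]
  {H : Type*} [TopologicalSpace H] {I : ModelWithCorners ℝ E H}
  {M : Type*} [TopologicalSpace M] [ChartedSpace H M] [IsManifold I ∞ M]

theorem eventually_mdifferentiableAt {E' H' M' : Type*} [NormedAddCommGroup E'] [NormedSpace ℝ E']
    [TopologicalSpace H'] {I' : ModelWithCorners ℝ E' H'} [TopologicalSpace M'] [ChartedSpace H' M']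
    [IsManifold I' 1 M'] [IsManifold I 1 M]
    {g : M → M'} {x : M} (hg : ContMDiffAt I I' ∞ g x) :
    ∀ᶠ y in 𝓝 x, MDifferentiableAt I I' g y :=
  ((contMDiffAt_iff_contMDiffAt_nhds (by simp)).1
    (hg.of_le (n := ∞) (m := 1) (mod_cast le_top))).mono
    fun _ hy ↦ hy.mdifferentiableAt (by simp)

theorem contMDiffAt_mvfderiv_apply {g : M → ℝ} {X : Π x : M, TangentSpace I x} {x : M}
    (hg : ContMDiffAt I 𝓘(ℝ, ℝ) ∞ g x) (hX : CMDiffAt ∞ (T% X) x) :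
    ContMDiffAt I 𝓘(ℝ, ℝ) ∞ (fun y ↦ d% g y (X y)) x := by
  have h1 := hg.mfderiv_const (m := ∞) (by simp)
  have h2 := h1.clm_apply_of_inCoordinates hX hg
  rw [contMDiffAt_totalSpace] at h2
  have h3 := h2.2
  simp only [mfld_simps] at h3
  exact h3

theorem contMDiffAt_mlieBracket {X Y : Π x : M, TangentSpace I x} {x : M}
    (hX : CMDiffAt ∞ (T% X) x) (hY : CMDiffAt ∞ (T% Y) x) :
    CMDiffAt ∞ (T% (VectorField.mlieBracket I X Y)) x := by
  have : CompleteSpace E := FiniteDimensional.complete ℝ E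
  have : IsManifold I (((⊤ : ℕ∞) : ℕ∞ω) + 1) M := by simpa
  have : IsManifold I (minSmoothness ℝ 2) M := by
    simpa using IsManifold.of_le (I := I) (M := M) (m := 2) (n := ∞)
      (show ((2 : ℕ∞) : ℕ∞ω) ≤ ((⊤ : ℕ∞) : ℕ∞ω) from mod_cast le_top)
  exact ContMDiffAt.mlieBracket_vectorField (m := ⊤) (n := ⊤) hX hY (by simp)

variable [RiemannianBundle (fun x : M ↦ TangentSpace I x)]
variable [IsContMDiffRiemannianBundle I ∞ E (fun x : M ↦ TangentSpace I x)]

theorem contMDiffAt_inner {x : M} {X Y : Π x : M, TangentSpace I x}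
    (hX : CMDiffAt ∞ (T% X) x) (hY : CMDiffAt ∞ (T% Y) x) :
    ContMDiffAt I 𝓘(ℝ, ℝ) ∞ (fun y ↦ inner ℝ (X y) (Y y)) x :=
  ContMDiffAt.inner_bundle (IB := I) (F := E) (E := fun x : M ↦ TangentSpace I x)
    (b := fun y ↦ y) (v := X) (w := Y) hX hY

theorem contMDiffAt_koszul {x : M} {X Y Z : Π x : M, TangentSpace I x}
    (hX : CMDiffAt ∞ (T% X) x) (hY : CMDiffAt ∞ (T% Y) x) (hZ : CMDiffAt ∞ (T% Z) x) :
    ContMDiffAt I 𝓘(ℝ, ℝ) ∞ (koszul X Y Z) x := by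
  unfold koszul
  have h1 := contMDiffAt_mvfderiv_apply (contMDiffAt_inner hY hZ) hX
  have h2 := contMDiffAt_mvfderiv_apply (contMDiffAt_inner hX hZ) hY
  have h3 := contMDiffAt_mvfderiv_apply (contMDiffAt_inner hX hY) hZ
  have h4 := contMDiffAt_inner (contMDiffAt_mlieBracket hX hY) hZ
  have h5 := contMDiffAt_inner (contMDiffAt_mlieBracket hX hZ) hY
  have h6 := contMDiffAt_inner (contMDiffAt_mlieBracket hY hZ) hX
  exact ((((h1.add h2).sub h3).add h4).sub h5).sub h6

/-- Smoothness on a neighbourhood of `x`. This is stronger than smoothness at `x` in the sense of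
`ContMDiffAt`, where the neighbourhood may depend on the order of differentiability. -/
def SmoothNear (X : Π x : M, TangentSpace I x) (x : M) : Prop :=
  ∀ᶠ y in 𝓝 x, CMDiffAt ∞ (T% X) y

theorem SmoothNear.contMDiffAt {X : Π x : M, TangentSpace I x} {x : M} (hX : SmoothNear X x) :
    CMDiffAt ∞ (T% X) x :=
  hX.self_of_nhds

/-- A family of vector fields which is smooth and orthonormal on a neighbourhood of `x`; its index
set has as many elements as the dimension. -/
structure IsOrthonormalFrameAt (e : Fin (Module.finrank ℝ E) → Π x : M, TangentSpace I x)
    (x : M) : Prop where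
  smoothNear : ∀ i, SmoothNear (e i) x
  orthonormal : ∀ᶠ y in 𝓝 x, Orthonormal ℝ (fun i ↦ e i y)

theorem IsOrthonormalFrameAt.contMDiffAt
    {e : Fin (Module.finrank ℝ E) → Π x : M, TangentSpace I x} {x : M}
    (he : IsOrthonormalFrameAt e x) (i : Fin (Module.finrank ℝ E)) : CMDiffAt ∞ (T% (e i)) x :=
  (he.smoothNear i).contMDiffAt

theorem IsOrthonormalFrameAt.eventually
    {e : Fin (Module.finrank ℝ E) → Π x : M, TangentSpace I x} {x : M}
    (he : IsOrthonormalFrameAt e x) : ∀ᶠ y in 𝓝 x, IsOrthonormalFrameAt e y := by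
  filter_upwards [eventually_all.2 fun i ↦ eventually_eventually_nhds.2 (he.smoothNear i),
    eventually_eventually_nhds.2 he.orthonormal] with y h1 h2
  exact ⟨h1, h2⟩

open InnerProductSpace in
/-- Gram-Schmidt orthogonalisation of smooth vector fields is smooth. -/
theorem contMDiffAt_gramSchmidt {ι : Type*} [LinearOrder ι] [LocallyFiniteOrderBot ι]
    [WellFoundedLT ι] {s : ι → Π x : M, TangentSpace I x} {x : M}
    (hs : ∀ i, CMDiffAt ∞ (T% (s i)) x) (hli : LinearIndependent ℝ (fun i ↦ s i x)) (i : ι) :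
    CMDiffAt ∞ (T% (fun y ↦ gramSchmidt ℝ (fun j ↦ s j y) i)) x := by
  induction i using WellFoundedLT.induction with
  | ind i ih =>
    have h : (fun y ↦ gramSchmidt ℝ (fun j ↦ s j y) i) =
        s i - fun y ↦ ∑ j ∈ Finset.Iio i,
          ((fun y ↦ inner ℝ (gramSchmidt ℝ (fun j ↦ s j y) j) (s i y) /
            inner ℝ (gramSchmidt ℝ (fun j ↦ s j y) j) (gramSchmidt ℝ (fun j ↦ s j y) j)) •
              (fun y ↦ gramSchmidt ℝ (fun j ↦ s j y) j)) y := by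
      funext y
      rw [gramSchmidt_def]
      simp only [Submodule.starProjection_singleton, Pi.sub_apply, Pi.smul_apply',
        real_inner_self_eq_norm_sq]
      rfl
    suffices hg : CMDiffAt ∞ (T% (s i - fun y ↦ ∑ j ∈ Finset.Iio i,
          ((fun y ↦ inner ℝ (gramSchmidt ℝ (fun j ↦ s j y) j) (s i y) /
            inner ℝ (gramSchmidt ℝ (fun j ↦ s j y) j) (gramSchmidt ℝ (fun j ↦ s j y) j)) •
              (fun y ↦ gramSchmidt ℝ (fun j ↦ s j y) j)) y)) x by
      rwa [← h] at hg
    refine (hs i).sub_section (ContMDiffAt.sum_section fun j hj ↦ ?_)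
    have hj' := ih j (Finset.mem_Iio.1 hj)
    refine ContMDiffAt.smul_section ?_ hj'
    refine (contMDiffAt_inner hj' (hs i)).div₀ (contMDiffAt_inner hj' hj') ?_
    rw [inner_self_ne_zero]
    exact gramSchmidt_ne_zero j hli

open InnerProductSpace in
theorem exists_isOrthonormalFrameAt (x : M) :
    ∃ e : Fin (Module.finrank ℝ E) → Π x : M, TangentSpace I x, IsOrthonormalFrameAt e x := by
  let t := trivializationAt E (fun x : M ↦ TangentSpace I x) x
  have hx : x ∈ t.baseSet := FiberBundle.mem_baseSet_trivializationAt' x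
  let b := Module.finBasis ℝ E
  let s := t.localFrame b
  have hb : ∀ᶠ y in 𝓝 x, y ∈ t.baseSet := t.open_baseSet.mem_nhds hx
  have hs {y} (hy : y ∈ t.baseSet) (i) : CMDiffAt ∞ (T% (s i)) y :=
    contMDiffAt_localFrame_of_mem ∞ _ b i hy
  have hfr := t.isLocalFrameOn_localFrame_baseSet I ∞ b
  have hli {y} (hy : y ∈ t.baseSet) : LinearIndependent ℝ (fun i ↦ s i y) :=
    hfr.linearIndependent hy
  refine ⟨fun i y ↦ gramSchmidtNormed ℝ (fun j ↦ s j y) i, fun i ↦ ?_, ?_⟩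
  · filter_upwards [hb] with x hx
    have h := contMDiffAt_gramSchmidt (hs hx) (hli hx) i
    have hne : gramSchmidt ℝ (fun j ↦ s j x) i ≠ 0 := gramSchmidt_ne_zero i (hli hx)
    have h2 : ContMDiffAt I 𝓘(ℝ, ℝ) ∞ (fun y ↦ ‖gramSchmidt ℝ (fun j ↦ s j y) i‖⁻¹) x := by
      have h3 := contMDiffAt_inner h h
      have h4 : ContDiffAt ℝ ∞ (fun r : ℝ ↦ (√r)⁻¹)
          (inner ℝ (gramSchmidt ℝ (fun j ↦ s j x) i) (gramSchmidt ℝ (fun j ↦ s j x) i)) := by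
        have h5 := (inner_self_ne_zero (𝕜 := ℝ)).2 hne
        exact (Real.contDiffAt_sqrt h5).inv (by
          rw [real_inner_self_eq_norm_sq, Real.sqrt_sq (norm_nonneg _)]; simpa using hne)
      have h5 := h4.contMDiffAt.comp x h3
      refine h5.congr_of_eventuallyEq (Eventually.of_forall fun y ↦ ?_)
      simp [Real.sqrt_sq (norm_nonneg _)]
    exact h2.smul_section h
  · filter_upwards [hb] with y hy
    exact gramSchmidtNormed_orthonormal (hli hy)

end Smoothness

/-! ### Calculus of vector fields and tensoriality -/

section Calculus

variable {E : Type*} [NormedAddCommGroup E] [NormedSpace ℝ E] [FiniteDimensional ℝ E]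
  {H : Type*} [TopologicalSpace H] {I : ModelWithCorners ℝ E H}
  {M : Type*} [TopologicalSpace M] [ChartedSpace H M] [IsManifold I ∞ M]

theorem isManifold_one_of_infty : IsManifold I 1 M :=
  IsManifold.of_le (n := ∞) (show ((1 : ℕ∞) : ℕ∞ω) ≤ ((⊤ : ℕ∞) : ℕ∞ω) from mod_cast le_top)

theorem eventually_mdifferentiableAt_vectorField {X : Π x : M, TangentSpace I x} {x : M}
    (hX : CMDiffAt ∞ (T% X) x) : ∀ᶠ y in 𝓝 x, MDiffAt (T% X) y := by
  have := isManifold_one_of_infty (I := I) (M := M)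
  exact eventually_mdifferentiableAt hX

theorem eventually_mdifferentiableAt_function {g : M → ℝ} {x : M}
    (hg : ContMDiffAt I 𝓘(ℝ, ℝ) ∞ g x) : ∀ᶠ y in 𝓝 x, MDiffAt g y := by
  have := isManifold_one_of_infty (I := I) (M := M)
  exact eventually_mdifferentiableAt hg

theorem contMDiffAt_extend_infty {x : M} (v : TangentSpace I x) :
    CMDiffAt ∞ (T% (extend E v : Π y : M, TangentSpace I y)) x :=
  contMDiffAt_extend I E v

theorem mdiffAt_vf {X : Π x : M, TangentSpace I x} {x : M}
    (hX : CMDiffAt ∞ (T% X) x) : MDiffAt (T% X) x := hX.mdifferentiableAt (by simp)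

theorem mdiffAt_fn {g : M → ℝ} {x : M}
    (hg : ContMDiffAt I 𝓘(ℝ, ℝ) ∞ g x) : MDiffAt g x := hg.mdifferentiableAt (by simp)

theorem contMDiffAt_vectorField_congr {X Y : Π x : M, TangentSpace I x} {x : M}
    (hX : CMDiffAt ∞ (T% X) x) (h : ∀ᶠ y in 𝓝 x, Y y = X y) : CMDiffAt ∞ (T% Y) x :=
  hX.congr_of_eventuallyEq (h.mono fun y hy ↦ by simp [hy])

theorem mvfderiv_congr {g g' : M → ℝ} {x : M} (h : ∀ᶠ y in 𝓝 x, g y = g' y) :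
    d% g x = d% g' x := by
  have h1 : g =ᶠ[𝓝 x] g' := h
  unfold mvfderiv
  rw [h1.mfderiv_eq, h1.self_of_nhds]

theorem mvfderiv_fun_sum {ι : Type*} {s : Finset ι} {g : ι → M → ℝ} {x : M}
    (hg : ∀ i ∈ s, MDiffAt (g i) x) :
    d% (fun y ↦ ∑ i ∈ s, g i y) x = ∑ i ∈ s, d% (g i) x := by
  classical
  have key : MDiffAt (fun y ↦ ∑ i ∈ s, g i y) x ∧
      d% (fun y ↦ ∑ i ∈ s, g i y) x = ∑ i ∈ s, d% (g i) x := by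
    induction s using Finset.induction_on with
    | empty => simpa using ⟨mdifferentiableAt_const, mvfderiv_const (I := I) (0 : ℝ) (x := x)⟩
    | insert a s ha ih =>
      have h1 := ih fun i hi ↦ hg i (Finset.mem_insert_of_mem hi)
      have h2 := hg a (Finset.mem_insert_self a s)
      simp only [Finset.sum_insert ha]
      exact ⟨h2.add h1.1, by rw [mvfderiv_fun_add h2 h1.1, h1.2]⟩
  exact key.2

/-- The bracket of vector fields is the commutator of derivations: `[X, Y]g = X(Yg) - Y(Xg)`. -/
theorem mvfderiv_mlieBracket {X Y : Π x : M, TangentSpace I x} {g : M → ℝ} {x : M}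
    (hX : CMDiffAt ∞ (T% X) x) (hY : CMDiffAt ∞ (T% Y) x)
    (hg : ContMDiffAt I 𝓘(ℝ, ℝ) ∞ g x) :
    d% g x (VectorField.mlieBracket I X Y x) =
      d% (fun y ↦ d% g y (Y y)) x (X x) - d% (fun y ↦ d% g y (X y)) x (Y x) := by
  -- The Jacobi identity for `X`, `Y` and `g • W` has this equation as its coefficient along `W`.
  have key (w : TangentSpace I x) : (d% g x (VectorField.mlieBracket I X Y x) -
      (d% (fun y ↦ d% g y (Y y)) x (X x) - d% (fun y ↦ d% g y (X y)) x (Y x))) • w = 0 := by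
    let W : Π y : M, TangentSpace I y := extend E w
    have hW : CMDiffAt ∞ (T% W) x := contMDiffAt_extend_infty w
    have hWx : W x = w := extend_apply_self ..
    have : CompleteSpace E := FiniteDimensional.complete ℝ E
    have : IsManifold I (minSmoothness ℝ 3) M := by
      simpa using IsManifold.of_le (I := I) (M := M) (m := 3) (n := ∞)
        (show ((3 : ℕ∞) : ℕ∞ω) ≤ ((⊤ : ℕ∞) : ℕ∞ω) from mod_cast le_top)
    have h2 : minSmoothness ℝ 2 ≤ ((⊤ : ℕ∞) : ℕ∞ω) := by
      simpa using (show ((2 : ℕ∞) : ℕ∞ω) ≤ ((⊤ : ℕ∞) : ℕ∞ω) from mod_cast le_top)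
    have hgW : CMDiffAt ∞ (T% (g • W)) x := hg.smul_section hW
    have J1 := VectorField.leibniz_identity_mlieBracket_apply (hX.of_le h2) (hY.of_le h2)
      (hgW.of_le h2)
    have J2 := VectorField.leibniz_identity_mlieBracket_apply (hX.of_le h2) (hY.of_le h2)
      (hW.of_le h2)
    have hXg := contMDiffAt_mvfderiv_apply hg hX
    have hYg := contMDiffAt_mvfderiv_apply hg hY
    have hXW := contMDiffAt_mlieBracket hX hW
    have hYW := contMDiffAt_mlieBracket hY hW
    have e (Z : Π x : M, TangentSpace I x) : ∀ᶠ y in 𝓝 x,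
        VectorField.mlieBracket I Z (g • W) y =
          ((fun y ↦ d% g y (Z y)) • W + g • VectorField.mlieBracket I Z W) y := by
      filter_upwards [eventually_mdifferentiableAt_vectorField hW,
        eventually_mdifferentiableAt_function hg] with y h1 h2
      simp [VectorField.mlieBracket_smul_right h2 h1]
    have eX : VectorField.mlieBracket I X (g • W) =ᶠ[𝓝 x] _ := e X
    have eY : VectorField.mlieBracket I Y (g • W) =ᶠ[𝓝 x] _ := e Y
    rw [EventuallyEq.mlieBracket_vectorField_eq (EventuallyEq.refl _ X) eY,
      EventuallyEq.mlieBracket_vectorField_eq (EventuallyEq.refl _ Y) eX,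
      (e (VectorField.mlieBracket I X Y)).self_of_nhds,
      VectorField.mlieBracket_add_right (mdiffAt_vf (hYg.smul_section hW))
        (mdiffAt_vf (hg.smul_section hYW)),
      VectorField.mlieBracket_add_right (mdiffAt_vf (hXg.smul_section hW))
        (mdiffAt_vf (hg.smul_section hXW)),
      VectorField.mlieBracket_smul_right (mdiffAt_fn hYg) (mdiffAt_vf hW),
      VectorField.mlieBracket_smul_right (mdiffAt_fn hXg) (mdiffAt_vf hW),
      VectorField.mlieBracket_smul_right (mdiffAt_fn hg) (mdiffAt_vf hXW),
      VectorField.mlieBracket_smul_right (mdiffAt_fn hg) (mdiffAt_vf hYW), J2] at J1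
    simp only [Pi.add_apply, Pi.smul_apply', hWx] at J1
    rw [← sub_eq_zero] at J1
    rw [← neg_eq_zero, ← J1]
    module
  rw [← sub_eq_zero]
  by_cases h : ∃ w : TangentSpace I x, w ≠ 0
  · obtain ⟨w, hw⟩ := h
    exact (smul_eq_zero.1 (key w)).resolve_right hw
  · push Not at h
    rw [h (X x), h (Y x), h (VectorField.mlieBracket I X Y x)]
    simp

variable [RiemannianBundle (fun x : M ↦ TangentSpace I x)]

/-- An orthonormal family indexed by the dimension is an orthonormal basis of the tangent space. -/
noncomputable def frameBasis {x : M} {b : Fin (Module.finrank ℝ E) → TangentSpace I x}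
    (hb : Orthonormal ℝ b) :
    OrthonormalBasis (Fin (Module.finrank ℝ E)) ℝ (TangentSpace I x) :=
  OrthonormalBasis.mk hb
    (hb.linearIndependent.span_eq_top_of_card_eq_finrank' (by rw [Fintype.card_fin]; rfl)).ge

@[simp]
theorem frameBasis_apply {x : M} {b : Fin (Module.finrank ℝ E) → TangentSpace I x}
    (hb : Orthonormal ℝ b) (i : Fin (Module.finrank ℝ E)) : frameBasis hb i = b i := by
  simp [frameBasis]

variable [IsContMDiffRiemannianBundle I ∞ E (fun x : M ↦ TangentSpace I x)]

namespace IsOrthonormalFrameAt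

variable {e : Fin (Module.finrank ℝ E) → Π x : M, TangentSpace I x} {x : M}

theorem eventually_sum_inner_smul (he : IsOrthonormalFrameAt e x) (X : Π x : M, TangentSpace I x) :
    ∀ᶠ y in 𝓝 x, X y = ∑ i, ((fun y ↦ (inner ℝ (e i y) (X y) : ℝ)) • e i) y := by
  filter_upwards [he.orthonormal] with y hy
  simpa using ((frameBasis hy).sum_repr' (X y)).symm

/-- A vector field is smooth if its components in the frame are. -/
theorem contMDiffAt_of_inner (he : IsOrthonormalFrameAt e x) {X : Π x : M, TangentSpace I x}
    (hX : ∀ i, ContMDiffAt I 𝓘(ℝ, ℝ) ∞ (fun y ↦ inner ℝ (e i y) (X y)) x) :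
    CMDiffAt ∞ (T% X) x :=
  contMDiffAt_vectorField_congr
    (ContMDiffAt.sum_section fun i _ ↦ (hX i).smul_section (he.contMDiffAt i))
    (he.eventually_sum_inner_smul X)

end IsOrthonormalFrameAt

/-- An operation on vector fields which is `C^∞`-linear at `x` on the fields smooth at `x`. In
contrast to `TensorialAt`, nothing is required on fields which are merely differentiable, so that
operations involving second derivatives are covered. -/
structure IsSmoothTensorialAt {A : Type*} [AddCommGroup A] [Module ℝ A]
    (Φ : (Π x : M, TangentSpace I x) → A) (x : M) : Prop where
  smul : ∀ {g : M → ℝ} {X : Π x : M, TangentSpace I x}, ContMDiffAt I 𝓘(ℝ, ℝ) ∞ g x →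
    CMDiffAt ∞ (T% X) x → Φ (g • X) = g x • Φ X
  add : ∀ {X Y : Π x : M, TangentSpace I x}, CMDiffAt ∞ (T% X) x → CMDiffAt ∞ (T% Y) x →
    Φ (X + Y) = Φ X + Φ Y

namespace IsSmoothTensorialAt

variable {A : Type*} [AddCommGroup A] [Module ℝ A]
  {Φ : (Π x : M, TangentSpace I x) → A} {x : M}

theorem congr_of_eventuallyEq (hΦ : IsSmoothTensorialAt Φ x) {X Y : Π x : M, TangentSpace I x}
    (hX : CMDiffAt ∞ (T% X) x) (hY : CMDiffAt ∞ (T% Y) x) (h : ∀ᶠ y in 𝓝 x, X y = Y y) :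
    Φ X = Φ Y := by
  classical
  -- The indicator function of the set where `X = Y` is smooth at `x`, which is all one needs.
  let ψ (y : M) : ℝ := if X y = Y y then 1 else 0
  have hψx : ψ x = 1 := by simp [ψ, h.self_of_nhds]
  have h1 : ψ • X = ψ • Y := by
    funext y
    by_cases hy : X y = Y y <;> simp [ψ, hy]
  have hψ : ContMDiffAt I 𝓘(ℝ, ℝ) ∞ ψ x :=
    (contMDiffAt_const (c := (1 : ℝ))).congr_of_eventuallyEq (h.mono fun y hy ↦ by simp [ψ, hy])
  simpa [hψx, hΦ.smul hψ hX, hΦ.smul hψ hY] using congrArg Φ h1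

theorem map_sum (hΦ : IsSmoothTensorialAt Φ x) {ι : Type*} {s : Finset ι}
    {X : ι → Π x : M, TangentSpace I x} (hX : ∀ i ∈ s, CMDiffAt ∞ (T% (X i)) x) :
    Φ (fun y ↦ ∑ i ∈ s, X i y) = ∑ i ∈ s, Φ (X i) := by
  classical
  induction s using Finset.induction_on with
  | empty =>
    have hz : CMDiffAt ∞ (T% (0 : Π x : M, TangentSpace I x)) x :=
      (contMDiff_zeroSection ℝ (fun x : M ↦ TangentSpace I x)).contMDiffAt
    have h := hΦ.smul (g := fun _ ↦ 0) (X := 0) contMDiffAt_const hz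
    simpa [← Pi.zero_def] using h
  | insert a s ha ih =>
    simp only [Finset.sum_insert ha]
    rw [← ih fun i hi ↦ hX i (Finset.mem_insert_of_mem hi)]
    exact hΦ.add (hX a (Finset.mem_insert_self a s))
      (ContMDiffAt.sum_section fun i hi ↦ hX i (Finset.mem_insert_of_mem hi))

/-- A tensorial operation depends only on the value of the vector field at the point. -/
theorem congr (hΦ : IsSmoothTensorialAt Φ x) {X Y : Π x : M, TangentSpace I x}
    (hX : CMDiffAt ∞ (T% X) x) (hY : CMDiffAt ∞ (T% Y) x) (h : X x = Y x) : Φ X = Φ Y := by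
  obtain ⟨e, he⟩ := exists_isOrthonormalFrameAt (I := I) x
  have key {Z : Π x : M, TangentSpace I x} (hZ : CMDiffAt ∞ (T% Z) x) :
      Φ Z = ∑ i, (inner ℝ (e i x) (Z x) : ℝ) • Φ (e i) := by
    have hs (i) := contMDiffAt_inner (he.contMDiffAt i) hZ
    rw [hΦ.congr_of_eventuallyEq hZ
      (ContMDiffAt.sum_section fun i _ ↦ (hs i).smul_section (he.contMDiffAt i))
      (he.eventually_sum_inner_smul Z),
      hΦ.map_sum fun i _ ↦ (hs i).smul_section (he.contMDiffAt i)]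
    exact Finset.sum_congr rfl fun i _ ↦ hΦ.smul (hs i) (he.contMDiffAt i)
  rw [key hX, key hY, h]

end IsSmoothTensorialAt

/-- The field `∇_X Y`. -/
noncomputable def nabla (X Y : Π x : M, TangentSpace I x) (x : M) : TangentSpace I x :=
  leviCivita Y x (X x)

section nabla

variable {X Y Z : Π x : M, TangentSpace I x} {g : M → ℝ} {x : M}

/-- By the Koszul formula, the components of `∇_X Y` in a smooth orthonormal frame are smooth. -/
theorem contMDiffAt_nabla (hX : CMDiffAt ∞ (T% X) x) (hY : CMDiffAt ∞ (T% Y) x) :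
    CMDiffAt ∞ (T% (nabla X Y)) x := by
  obtain ⟨e, he⟩ := exists_isOrthonormalFrameAt (I := I) x
  refine he.contMDiffAt_of_inner fun i ↦ ?_
  have h := (contMDiffAt_const (c := (1 / 2 : ℝ))).mul
    (contMDiffAt_koszul hX hY (he.contMDiffAt i))
  refine h.congr_of_eventuallyEq ?_
  filter_upwards [eventually_mdifferentiableAt_vectorField hX,
    eventually_mdifferentiableAt_vectorField hY,
    eventually_mdifferentiableAt_vectorField (he.contMDiffAt i)] with y h1 h2 h3
  have h4 := two_mul_inner_leviCivitaAux h1 h2 h3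
  rw [real_inner_comm]
  change inner ℝ (leviCivitaAux Y y (X y)) _ = _ * _
  linarith

theorem nabla_add_right (hY : CMDiffAt ∞ (T% Y) x) (hZ : CMDiffAt ∞ (T% Z) x) :
    nabla X (Y + Z) x = nabla X Y x + nabla X Z x := by
  simp [nabla, leviCivita.isCovariantDerivativeOnUniv.add (mdiffAt_vf hY) (mdiffAt_vf hZ)]

theorem nabla_smul_right (hg : ContMDiffAt I 𝓘(ℝ, ℝ) ∞ g x) (hY : CMDiffAt ∞ (T% Y) x) :
    nabla X (g • Y) x = g x • nabla X Y x + d% g x (X x) • Y x := by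
  simp [nabla, leviCivita.isCovariantDerivativeOnUniv.leibniz (mdiffAt_vf hY) (mdiffAt_fn hg)]

theorem nabla_neg_right (hY : CMDiffAt ∞ (T% Y) x) : nabla X (-Y) x = -nabla X Y x := by
  have h := leviCivita.isCovariantDerivativeOnUniv.smul_const (-1 : ℝ) (mdiffAt_vf hY)
  simpa [nabla] using congrArg (· (X x)) h

theorem nabla_sub_right (hY : CMDiffAt ∞ (T% Y) x) (hZ : CMDiffAt ∞ (T% Z) x) :
    nabla X (Y - Z) x = nabla X Y x - nabla X Z x := by
  rw [sub_eq_add_neg, nabla_add_right hY hZ.neg_section, nabla_neg_right hZ, sub_eq_add_neg]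

theorem nabla_congr_right (hY : CMDiffAt ∞ (T% Y) x) (hZ : CMDiffAt ∞ (T% Z) x)
    (h : ∀ᶠ y in 𝓝 x, Y y = Z y) : nabla X Y x = nabla X Z x := by
  rw [nabla, nabla]
  exact congrArg (· (X x)) (leviCivita.isCovariantDerivativeOnUniv.congr_of_eventuallyEq
    (mdiffAt_vf hY) (mdiffAt_vf hZ) univ_mem h)

theorem nabla_add_left : nabla (X + Y) Z = nabla X Z + nabla Y Z := by
  funext y; simp [nabla]

theorem nabla_neg_left : nabla (-X) Z = -nabla X Z := by
  funext y; simp [nabla]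

theorem nabla_smul_left : nabla (g • X) Z = g • nabla X Z := by
  funext y; simp [nabla]

theorem nabla_sub_nabla (hX : CMDiffAt ∞ (T% X) x) (hY : CMDiffAt ∞ (T% Y) x) :
    nabla X Y x - nabla Y X x = VectorField.mlieBracket I X Y x :=
  leviCivita_torsionFree (mdiffAt_vf hX) (mdiffAt_vf hY)

theorem mvfderiv_inner (hY : CMDiffAt ∞ (T% Y) x) (hZ : CMDiffAt ∞ (T% Z) x) :
    d% (fun y ↦ inner ℝ (Y y) (Z y)) x (X x) =
      inner ℝ (nabla X Y x) (Z x) + inner ℝ (Y x) (nabla X Z x) :=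
  leviCivita_metric (mdiffAt_vf hY) (mdiffAt_vf hZ) (X x)

end nabla

section grad

variable {X Y : Π x : M, TangentSpace I x} {g : M → ℝ} {x : M}

theorem inner_grad (g : M → ℝ) (x : M) (v : TangentSpace I x) :
    inner ℝ (grad I g x) v = d% g x v := by
  simp [grad]

theorem contMDiffAt_grad (hg : ContMDiffAt I 𝓘(ℝ, ℝ) ∞ g x) : CMDiffAt ∞ (T% (grad I g)) x := by
  obtain ⟨e, he⟩ := exists_isOrthonormalFrameAt (I := I) x
  refine he.contMDiffAt_of_inner fun i ↦ ?_
  refine (contMDiffAt_mvfderiv_apply hg (he.contMDiffAt i)).congr_of_eventuallyEq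
    (Eventually.of_forall fun y ↦ ?_)
  exact (real_inner_comm _ _).trans (inner_grad g y _)

/-- The Hessian of a function is symmetric. -/
theorem inner_nabla_grad_comm (hg : ContMDiffAt I 𝓘(ℝ, ℝ) ∞ g x)
    (hX : CMDiffAt ∞ (T% X) x) (hY : CMDiffAt ∞ (T% Y) x) :
    inner ℝ (nabla X (grad I g) x) (Y x) = inner ℝ (nabla Y (grad I g) x) (X x) := by
  have hG := contMDiffAt_grad hg
  have h1 := mvfderiv_inner (X := X) hG hY
  have h2 := mvfderiv_inner (X := Y) hG hX
  have h3 := mvfderiv_mlieBracket hX hY hg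
  rw [← nabla_sub_nabla hX hY] at h3
  simp only [inner_grad, map_sub] at h1 h2 h3
  linarith

end grad

end Calculus

/-! ### Curvature and traces in a frame -/

section LinearAlgebra

variable {F : Type*} [NormedAddCommGroup F] [InnerProductSpace ℝ F]
  {A : Type*} [AddCommGroup A] [Module ℝ A] {ι κ : Type*} [Fintype ι] [Fintype κ]

/-- The metric trace of a bilinear map does not depend on the orthonormal basis. -/
theorem sum_apply_orthonormalBasis (B : F →ₗ[ℝ] F →ₗ[ℝ] A) (b : OrthonormalBasis ι ℝ F)
    (c : OrthonormalBasis κ ℝ F) : ∑ i, B (b i) (b i) = ∑ j, B (c j) (c j) := by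
  have h1 (i) : B (b i) (b i) = ∑ j, (inner ℝ (c j) (b i) : ℝ) • B (c j) (b i) := by
    conv_lhs => enter [1, 2]; rw [← c.sum_repr' (b i)]
    simp
  have h2 (j) : B (c j) (c j) = ∑ i, (inner ℝ (b i) (c j) : ℝ) • B (c j) (b i) := by
    conv_lhs => enter [2]; rw [← b.sum_repr' (c j)]
    simp
  simp only [h1, h2]
  rw [Finset.sum_comm]
  simp only [real_inner_comm]

/-- A rotation of the orthonormal basis, with infinitesimal generator `b i ↦ a i`, does not change
the metric trace of a bilinear map. -/
theorem sum_apply_add_apply_of_skew (B : F →ₗ[ℝ] F →ₗ[ℝ] A) (b : OrthonormalBasis ι ℝ F)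
    {a : ι → F} (ha : ∀ i j, inner ℝ (a i) (b j) + inner ℝ (b i) (a j) = (0 : ℝ)) :
    ∑ i, (B (a i) (b i) + B (b i) (a i)) = 0 := by
  have h1 (i) : B (a i) (b i) = ∑ j, (inner ℝ (b j) (a i) : ℝ) • B (b j) (b i) := by
    conv_lhs => rw [← b.sum_repr' (a i)]
    simp
  have h2 (i) : B (b i) (a i) = ∑ j, (inner ℝ (b j) (a i) : ℝ) • B (b i) (b j) := by
    conv_lhs => rw [← b.sum_repr' (a i)]
    simp
  rw [Finset.sum_add_distrib]
  simp only [h1, h2]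
  rw [Finset.sum_comm, ← Finset.sum_add_distrib]
  refine Finset.sum_eq_zero fun i _ ↦ ?_
  rw [← Finset.sum_add_distrib]
  refine Finset.sum_eq_zero fun j _ ↦ ?_
  rw [← add_smul, real_inner_comm (a j) (b i), ha j i, zero_smul]

end LinearAlgebra

section Curvature

variable {E : Type*} [NormedAddCommGroup E] [NormedSpace ℝ E] [FiniteDimensional ℝ E]
  {H : Type*} [TopologicalSpace H] {I : ModelWithCorners ℝ E H}
  {M : Type*} [TopologicalSpace M] [ChartedSpace H M] [IsManifold I ∞ M]
  [RiemannianBundle (fun x : M ↦ TangentSpace I x)]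
  [IsContMDiffRiemannianBundle I ∞ E (fun x : M ↦ TangentSpace I x)]

/-- The curvature field `R(X, Y)Z = ∇_X ∇_Y Z - ∇_Y ∇_X Z - ∇_{[X, Y]} Z`. -/
noncomputable def riemann (X Y Z : Π x : M, TangentSpace I x) : Π x : M, TangentSpace I x :=
  nabla X (nabla Y Z) - nabla Y (nabla X Z) - nabla (VectorField.mlieBracket I X Y) Z

/-- The second covariant derivative `∇²_{X, Y} Z = ∇_X ∇_Y Z - ∇_{∇_X Y} Z`. -/
noncomputable def nabla₂ (X Y Z : Π x : M, TangentSpace I x) : Π x : M, TangentSpace I x :=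
  nabla X (nabla Y Z) - nabla (nabla X Y) Z

variable {X Y Z : Π x : M, TangentSpace I x} {g : M → ℝ} {x : M}

theorem contMDiffAt_riemann (hX : CMDiffAt ∞ (T% X) x) (hY : CMDiffAt ∞ (T% Y) x)
    (hZ : CMDiffAt ∞ (T% Z) x) : CMDiffAt ∞ (T% (riemann X Y Z)) x :=
  ((contMDiffAt_nabla hX (contMDiffAt_nabla hY hZ)).sub_section
    (contMDiffAt_nabla hY (contMDiffAt_nabla hX hZ))).sub_section
    (contMDiffAt_nabla (contMDiffAt_mlieBracket hX hY) hZ)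

theorem riemann_swap : riemann X Y Z = -riemann Y X Z := by
  rw [riemann, riemann, VectorField.mlieBracket_swap (V := X), nabla_neg_left]
  abel

/-- The Ricci identity. -/
theorem nabla₂_sub_nabla₂ (hX : CMDiffAt ∞ (T% X) x) (hY : CMDiffAt ∞ (T% Y) x) :
    nabla₂ X Y Z x - nabla₂ Y X Z x = riemann X Y Z x := by
  have h : nabla (VectorField.mlieBracket I X Y) Z x = nabla (nabla X Y) Z x -
      nabla (nabla Y X) Z x := by
    rw [nabla, ← nabla_sub_nabla hX hY, map_sub]
    rfl
  simp only [nabla₂, riemann, Pi.sub_apply, h]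
  abel

theorem isSmoothTensorialAt_nabla₂_middle (hZ : CMDiffAt ∞ (T% Z) x) :
    IsSmoothTensorialAt (fun Y ↦ nabla₂ X Y Z x) x where
  smul {g Y} hg hY := by
    have h1 : nabla X (nabla (g • Y) Z) x = _ :=
      (congrArg (nabla X · x) nabla_smul_left).trans (nabla_smul_right hg (contMDiffAt_nabla hY hZ))
    have h2 : nabla (nabla X (g • Y)) Z x = _ := congrArg (leviCivita Z x) (nabla_smul_right hg hY)
    simp only [nabla₂, Pi.sub_apply, h1, h2, map_add, map_smul]
    simp only [nabla]
    module
  add {Y Y'} hY hY' := by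
    have h1 : nabla X (nabla (Y + Y') Z) x = _ :=
      (congrArg (nabla X · x) nabla_add_left).trans
        (nabla_add_right (contMDiffAt_nabla hY hZ) (contMDiffAt_nabla hY' hZ))
    have h2 : nabla (nabla X (Y + Y')) Z x = _ := congrArg (leviCivita Z x) (nabla_add_right hY hY')
    simp only [nabla₂, Pi.sub_apply, h1, h2, map_add]
    simp only [nabla]
    abel

theorem isSmoothTensorialAt_riemann_left (hZ : CMDiffAt ∞ (T% Z) x) :
    IsSmoothTensorialAt (fun X ↦ riemann X Y Z x) x where
  smul {g X} hg hX := by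
    have h1 : nabla Y (nabla (g • X) Z) x = _ :=
      (congrArg (nabla Y · x) nabla_smul_left).trans (nabla_smul_right hg (contMDiffAt_nabla hX hZ))
    have h2 : nabla (VectorField.mlieBracket I (g • X) Y) Z x = _ :=
      congrArg (leviCivita Z x) (VectorField.mlieBracket_smul_left (mdiffAt_fn hg) (mdiffAt_vf hX))
    simp only [riemann, Pi.sub_apply, h1, h2, map_add, map_smul]
    simp only [nabla, Pi.smul_apply', map_smul]
    module
  add {X X'} hX hX' := by
    have h1 : nabla Y (nabla (X + X') Z) x = _ :=
      (congrArg (nabla Y · x) nabla_add_left).trans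
        (nabla_add_right (contMDiffAt_nabla hX hZ) (contMDiffAt_nabla hX' hZ))
    have h2 : nabla (VectorField.mlieBracket I (X + X') Y) Z x = _ :=
      congrArg (leviCivita Z x) (VectorField.mlieBracket_add_left (mdiffAt_vf hX) (mdiffAt_vf hX'))
    simp only [riemann, Pi.sub_apply, h1, h2, map_add]
    simp only [nabla, Pi.add_apply, map_add]
    abel

theorem isSmoothTensorialAt_riemann_middle (hZ : CMDiffAt ∞ (T% Z) x) :
    IsSmoothTensorialAt (fun Y ↦ riemann X Y Z x) x where
  smul hg hY := by
    have h := (isSmoothTensorialAt_riemann_left (Y := X) hZ).smul hg hY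
    simp only [riemann_swap (X := X), Pi.neg_apply] at h ⊢
    rw [h, smul_neg]
  add hY hY' := by
    have h := (isSmoothTensorialAt_riemann_left (Y := X) hZ).add hY hY'
    simp only [riemann_swap (X := X), Pi.neg_apply] at h ⊢
    rw [h, neg_add]

/-- In `Z`, the second derivatives of a coefficient `g` enter through `X(Yg) - Y(Xg) - [X, Y]g`,
which vanishes. -/
theorem isSmoothTensorialAt_riemann_right (hX : CMDiffAt ∞ (T% X) x) (hY : CMDiffAt ∞ (T% Y) x) :
    IsSmoothTensorialAt (fun Z ↦ riemann X Y Z x) x where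
  smul {g Z} hg hZ := by
    have h (U V : Π x : M, TangentSpace I x) (hV : CMDiffAt ∞ (T% V) x) :
        nabla U (nabla V (g • Z)) x = g x • nabla U (nabla V Z) x +
          d% g x (U x) • nabla V Z x + (d% g x (V x) • nabla U Z x +
          d% (fun y ↦ d% g y (V y)) x (U x) • Z x) := by
      have hVZ := contMDiffAt_nabla hV hZ
      have hVg := contMDiffAt_mvfderiv_apply hg hV
      rw [← nabla_smul_right hg hVZ, ← nabla_smul_right hVg hZ,
        ← nabla_add_right (hg.smul_section hVZ) (hVg.smul_section hZ)]
      refine nabla_congr_right (contMDiffAt_nabla hV (hg.smul_section hZ))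
        ((hg.smul_section hVZ).add_section (hVg.smul_section hZ)) ?_
      filter_upwards [eventually_mdifferentiableAt_vectorField hZ,
        eventually_mdifferentiableAt_function hg] with y h1 h2
      simp [nabla, leviCivita.isCovariantDerivativeOnUniv.leibniz h1 h2]
    simp only [riemann, Pi.sub_apply, h X Y hY, h Y X hX, nabla_smul_right hg hZ,
      mvfderiv_mlieBracket hX hY hg]
    module
  add {Z Z'} hZ hZ' := by
    have h (U V : Π x : M, TangentSpace I x) (hV : CMDiffAt ∞ (T% V) x) :
        nabla U (nabla V (Z + Z')) x = nabla U (nabla V Z) x + nabla U (nabla V Z') x := by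
      have h1 := contMDiffAt_nabla hV hZ
      have h2 := contMDiffAt_nabla hV hZ'
      rw [← nabla_add_right h1 h2]
      refine nabla_congr_right (contMDiffAt_nabla hV (hZ.add_section hZ'))
        (h1.add_section h2) ?_
      filter_upwards [eventually_mdifferentiableAt_vectorField hZ,
        eventually_mdifferentiableAt_vectorField hZ'] with y h1 h2
      simp [nabla, leviCivita.isCovariantDerivativeOnUniv.add h1 h2]
    simp only [riemann, Pi.sub_apply, h X Y hY, h Y X hX, nabla_add_right hZ hZ']
    abel

/-- The pointwise curvature may be computed with any smooth extensions. -/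
theorem curvature_apply (hX : CMDiffAt ∞ (T% X) x) (hY : CMDiffAt ∞ (T% Y) x)
    (hZ : CMDiffAt ∞ (T% Z) x) : curvature x (X x) (Y x) (Z x) = riemann X Y Z x := by
  have hX' := contMDiffAt_extend_infty (X x)
  have hY' := contMDiffAt_extend_infty (Y x)
  have hZ' := contMDiffAt_extend_infty (Z x)
  have h0 : curvature x (X x) (Y x) (Z x) =
      riemann (extend E (X x)) (extend E (Y x)) (extend E (Z x)) x := by
    simp [curvature, riemann, nabla]
    rfl
  rw [h0, (isSmoothTensorialAt_riemann_left hZ').congr hX' hX (extend_apply_self ..),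
    (isSmoothTensorialAt_riemann_middle hZ').congr hY' hY (extend_apply_self ..),
    (isSmoothTensorialAt_riemann_right hX hY).congr hZ' hZ (extend_apply_self ..)]

/-- The second covariant derivative may be computed with any smooth extensions. -/
theorem secondCovDeriv_apply (hY : CMDiffAt ∞ (T% Y) x) (hZ : CMDiffAt ∞ (T% Z) x) :
    secondCovDeriv Z x (X x) (Y x) = nabla₂ X Y Z x :=
  (isSmoothTensorialAt_nabla₂_middle (X := X) hZ).congr (contMDiffAt_extend_infty (Y x)) hY
    (extend_apply_self ..)

theorem IsSmoothTensorialAt.isLinearMap_extend {A : Type*} [AddCommGroup A] [Module ℝ A]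
    {Φ : (Π x : M, TangentSpace I x) → A} (hΦ : IsSmoothTensorialAt Φ x) :
    IsLinearMap ℝ (fun v : TangentSpace I x ↦ Φ (extend E v)) where
  map_add u v := by
    have hu := contMDiffAt_extend_infty u
    have hv := contMDiffAt_extend_infty v
    rw [← hΦ.add hu hv]
    exact hΦ.congr (contMDiffAt_extend_infty _) (hu.add_section hv) (by simp)
  map_smul c v := by
    have hv := contMDiffAt_extend_infty v
    have hc : ContMDiffAt I 𝓘(ℝ, ℝ) ∞ (fun _ : M ↦ c) x := contMDiffAt_const
    rw [← hΦ.smul hc hv]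
    exact hΦ.congr (contMDiffAt_extend_infty _) (hc.smul_section hv) (by simp)

theorem curvature_eq_riemann_extend (u v w : TangentSpace I x) :
    curvature x u v w = riemann (extend E u) (extend E v) (extend E w) x := by
  simpa using curvature_apply (contMDiffAt_extend_infty u) (contMDiffAt_extend_infty v)
    (contMDiffAt_extend_infty w)

theorem isLinearMap_curvature_left (v w : TangentSpace I x) :
    IsLinearMap ℝ (fun u ↦ curvature x u v w) := by
  simp only [curvature_eq_riemann_extend]
  exact (isSmoothTensorialAt_riemann_left (contMDiffAt_extend_infty w)).isLinearMap_extend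

theorem isLinearMap_curvature_middle (u w : TangentSpace I x) :
    IsLinearMap ℝ (fun v ↦ curvature x u v w) := by
  simp only [curvature_eq_riemann_extend]
  exact (isSmoothTensorialAt_riemann_middle (contMDiffAt_extend_infty w)).isLinearMap_extend

theorem isLinearMap_curvature_right (u v : TangentSpace I x) :
    IsLinearMap ℝ (fun w ↦ curvature x u v w) := by
  simp only [curvature_eq_riemann_extend]
  exact (isSmoothTensorialAt_riemann_right (contMDiffAt_extend_infty u)
    (contMDiffAt_extend_infty v)).isLinearMap_extend

/-- The bilinear form `(u, u') ↦ ⟨R(u, v)w, u'⟩`, whose trace is `Ric(v, w)`. -/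
noncomputable def curvatureForm (v w : TangentSpace I x) :
    TangentSpace I x →ₗ[ℝ] TangentSpace I x →ₗ[ℝ] ℝ :=
  LinearMap.mk₂ ℝ (fun u u' ↦ inner ℝ (curvature x u v w) u')
    (fun u₁ u₂ u' ↦ by rw [(isLinearMap_curvature_left v w).map_add, inner_add_left])
    (fun c u u' ↦ by
      rw [(isLinearMap_curvature_left v w).map_smul, real_inner_smul_left, smul_eq_mul])
    (fun _ _ _ ↦ inner_add_right _ _ _)
    (fun _ _ _ ↦ by rw [real_inner_smul_right, smul_eq_mul])

/-- The Ricci tensor at `x` as a bilinear form. -/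
noncomputable def ricciForm (x : M) : TangentSpace I x →ₗ[ℝ] TangentSpace I x →ₗ[ℝ] ℝ :=
  LinearMap.mk₂ ℝ (ricci x)
    (fun _ _ _ ↦ by
      simp only [ricci, (isLinearMap_curvature_middle _ _).map_add, inner_add_left,
        Finset.sum_add_distrib])
    (fun _ _ _ ↦ by
      simp only [ricci, (isLinearMap_curvature_middle _ _).map_smul, real_inner_smul_left,
        ← Finset.mul_sum, smul_eq_mul])
    (fun _ _ _ ↦ by
      simp only [ricci, (isLinearMap_curvature_right _ _).map_add, inner_add_left,
        Finset.sum_add_distrib])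
    (fun _ _ _ ↦ by
      simp only [ricci, (isLinearMap_curvature_right _ _).map_smul, real_inner_smul_left,
        ← Finset.mul_sum, smul_eq_mul])

@[simp]
theorem ricciForm_apply (x : M) (v w : TangentSpace I x) : ricciForm x v w = ricci x v w := rfl

/-- The second covariant derivative at `x` of a vector field smooth at `x`, as a bilinear map. -/
noncomputable def secondCovDerivHom (hZ : CMDiffAt ∞ (T% Z) x) :
    TangentSpace I x →ₗ[ℝ] TangentSpace I x →ₗ[ℝ] TangentSpace I x :=
  have hlin (u : TangentSpace I x) : IsLinearMap ℝ (fun w ↦ secondCovDeriv Z x u w) := by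
    have h (w : TangentSpace I x) :
        secondCovDeriv Z x u w = nabla₂ (extend E u) (extend E w) Z x := by
      simpa using secondCovDeriv_apply (X := extend E u) (contMDiffAt_extend_infty w) hZ
    simp only [h]
    exact (isSmoothTensorialAt_nabla₂_middle hZ).isLinearMap_extend
  LinearMap.mk₂ ℝ (secondCovDeriv Z x)
    (fun _ _ _ ↦ by simp only [secondCovDeriv, map_add]; abel)
    (fun _ _ _ ↦ by simp only [secondCovDeriv, map_smul, smul_sub])
    (fun u ↦ (hlin u).map_add)
    (fun c u w ↦ (hlin u).map_smul c w)

namespace IsOrthonormalFrameAt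

variable {e : Fin (Module.finrank ℝ E) → Π x : M, TangentSpace I x}

theorem ricci_eq_sum (he : IsOrthonormalFrameAt e x) (v w : TangentSpace I x) :
    ricci x v w = ∑ i, inner ℝ (curvature x (e i x) v w) (e i x) := by
  have h := sum_apply_orthonormalBasis (curvatureForm v w)
    (stdOrthonormalBasis ℝ (TangentSpace I x)) (frameBasis he.orthonormal.self_of_nhds)
  simp only [frameBasis_apply] at h
  exact h

theorem ricci_apply (he : IsOrthonormalFrameAt e x) (hX : CMDiffAt ∞ (T% X) x)
    (hY : CMDiffAt ∞ (T% Y) x) :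
    ricci x (X x) (Y x) = ∑ i, inner ℝ (riemann (e i) X Y x) (e i x) := by
  simp only [he.ricci_eq_sum, curvature_apply (he.contMDiffAt _) hX hY]

theorem scalarCurvature_eq_sum (he : IsOrthonormalFrameAt e x) :
    scalarCurvature I x = ∑ i, ricci x (e i x) (e i x) := by
  have h := sum_apply_orthonormalBasis (ricciForm x)
    (stdOrthonormalBasis ℝ (TangentSpace I x)) (frameBasis he.orthonormal.self_of_nhds)
  simp only [frameBasis_apply] at h
  exact h

theorem roughLaplacian_eq_sum (he : IsOrthonormalFrameAt e x) (hZ : CMDiffAt ∞ (T% Z) x) :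
    roughLaplacian Z x = ∑ i, nabla₂ (e i) (e i) Z x := by
  have h := sum_apply_orthonormalBasis (secondCovDerivHom hZ)
    (stdOrthonormalBasis ℝ (TangentSpace I x)) (frameBasis he.orthonormal.self_of_nhds)
  simp only [← secondCovDeriv_apply (he.contMDiffAt _) hZ]
  simp only [frameBasis_apply] at h
  exact h

theorem divergence_eq_sum (he : IsOrthonormalFrameAt e x) (Z : Π x : M, TangentSpace I x) :
    divergence Z x = ∑ i, inner ℝ (nabla (e i) Z x) (e i x) := by
  rw [divergence, LinearMap.trace_eq_sum_inner _ (frameBasis he.orthonormal.self_of_nhds)]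
  refine Finset.sum_congr rfl fun i _ ↦ ?_
  rw [frameBasis_apply, real_inner_comm]
  rfl

/-- Differentiating an orthonormal frame gives a skew matrix. -/
theorem inner_nabla_skew (he : IsOrthonormalFrameAt e x) (X : Π x : M, TangentSpace I x)
    (i j : Fin (Module.finrank ℝ E)) :
    inner ℝ (nabla X (e i) x) (e j x) + inner ℝ (e i x) (nabla X (e j) x) = (0 : ℝ) := by
  rw [← mvfderiv_inner (he.contMDiffAt i) (he.contMDiffAt j),
    mvfderiv_congr (g' := fun _ ↦ if i = j then (1 : ℝ) else 0), mvfderiv_const]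
  · simp
  · filter_upwards [he.orthonormal] with y hy
    exact orthonormal_iff_ite.1 hy i j

/-- The derivatives of the frame contribute nothing to a trace. -/
theorem sum_apply_nabla (he : IsOrthonormalFrameAt e x) {A : Type*} [AddCommGroup A] [Module ℝ A]
    (B : TangentSpace I x →ₗ[ℝ] TangentSpace I x →ₗ[ℝ] A) (X : Π x : M, TangentSpace I x) :
    ∑ i, (B (nabla X (e i) x) (e i x) + B (e i x) (nabla X (e i) x)) = 0 := by
  have h := sum_apply_add_apply_of_skew B (frameBasis he.orthonormal.self_of_nhds)
    (a := fun i ↦ nabla X (e i) x) (fun i j ↦ by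
      simpa only [frameBasis_apply] using he.inner_nabla_skew X i j)
  simp only [frameBasis_apply] at h
  exact h

end IsOrthonormalFrameAt

theorem contMDiffAt_fun_sum {ι : Type*} {s : Finset ι} {g : ι → M → ℝ}
    (hg : ∀ i ∈ s, ContMDiffAt I 𝓘(ℝ, ℝ) ∞ (g i) x) :
    ContMDiffAt I 𝓘(ℝ, ℝ) ∞ (fun y ↦ ∑ i ∈ s, g i y) x :=
  ContMDiffAt.sum hg

theorem contMDiffAt_ricci (hX : SmoothNear X x) (hY : SmoothNear Y x) :
    ContMDiffAt I 𝓘(ℝ, ℝ) ∞ (fun y ↦ ricci y (X y) (Y y)) x := by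
  obtain ⟨e, he⟩ := exists_isOrthonormalFrameAt (I := I) x
  refine (contMDiffAt_fun_sum (s := Finset.univ) fun i _ ↦
    contMDiffAt_inner (contMDiffAt_riemann (he.contMDiffAt i) hX.contMDiffAt hY.contMDiffAt)
      (he.contMDiffAt i)).congr_of_eventuallyEq ?_
  filter_upwards [he.eventually, hX, hY] with y h1 h2 h3 using h1.ricci_apply h2 h3

theorem contMDiffAt_scalarCurvature (x : M) :
    ContMDiffAt I 𝓘(ℝ, ℝ) ∞ (scalarCurvature I) x := by
  obtain ⟨e, he⟩ := exists_isOrthonormalFrameAt (I := I) x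
  refine (contMDiffAt_fun_sum (s := Finset.univ) fun i _ ↦ contMDiffAt_ricci (he.smoothNear i)
    (he.smoothNear i)).congr_of_eventuallyEq ?_
  filter_upwards [he.eventually] with y h using h.scalarCurvature_eq_sum

theorem contMDiffAt_divergence (hX : CMDiffAt ∞ (T% X) x) :
    ContMDiffAt I 𝓘(ℝ, ℝ) ∞ (divergence X) x := by
  obtain ⟨e, he⟩ := exists_isOrthonormalFrameAt (I := I) x
  refine (contMDiffAt_fun_sum (s := Finset.univ) fun i _ ↦
    contMDiffAt_inner (contMDiffAt_nabla (he.contMDiffAt i) hX)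
      (he.contMDiffAt i)).congr_of_eventuallyEq ?_
  filter_upwards [he.eventually] with y h using h.divergence_eq_sum X

end Curvature

/-! ### Bianchi identities -/

section Bianchi

variable {E : Type*} [NormedAddCommGroup E] [NormedSpace ℝ E] [FiniteDimensional ℝ E]
  {H : Type*} [TopologicalSpace H] {I : ModelWithCorners ℝ E H}
  {M : Type*} [TopologicalSpace M] [ChartedSpace H M] [IsManifold I ∞ M]

variable {U X Y Z W : Π x : M, TangentSpace I x} {x : M}

/-- The Jacobi identity in cyclic form. -/
theorem mlieBracket_jacobi (hX : CMDiffAt ∞ (T% X) x) (hY : CMDiffAt ∞ (T% Y) x)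
    (hZ : CMDiffAt ∞ (T% Z) x) :
    VectorField.mlieBracket I (VectorField.mlieBracket I X Y) Z x +
      VectorField.mlieBracket I (VectorField.mlieBracket I Y Z) X x +
      VectorField.mlieBracket I (VectorField.mlieBracket I Z X) Y x = 0 := by
  have : CompleteSpace E := FiniteDimensional.complete ℝ E
  have : IsManifold I (minSmoothness ℝ 3) M := by
    simpa using IsManifold.of_le (I := I) (M := M) (m := 3) (n := ∞)
      (show ((3 : ℕ∞) : ℕ∞ω) ≤ ((⊤ : ℕ∞) : ℕ∞ω) from mod_cast le_top)
  have h2 : minSmoothness ℝ 2 ≤ ((⊤ : ℕ∞) : ℕ∞ω) := by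
    simpa using (show ((2 : ℕ∞) : ℕ∞ω) ≤ ((⊤ : ℕ∞) : ℕ∞ω) from mod_cast le_top)
  have J := VectorField.leibniz_identity_mlieBracket_apply (hX.of_le h2) (hY.of_le h2)
    (hZ.of_le h2)
  have h3 : VectorField.mlieBracket I Y (VectorField.mlieBracket I X Z) x =
      VectorField.mlieBracket I (VectorField.mlieBracket I Z X) Y x := by
    have h : VectorField.mlieBracket I X Z = (-1 : ℝ) • VectorField.mlieBracket I Z X := by
      rw [VectorField.mlieBracket_swap, neg_one_smul]
    rw [h, VectorField.mlieBracket_const_smul_right (mdiffAt_vf (contMDiffAt_mlieBracket hZ hX)),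
      VectorField.mlieBracket_swap_apply, smul_neg, neg_one_smul, neg_neg]
  rw [VectorField.mlieBracket_swap_apply, h3] at J
  rw [add_right_comm, ← J, neg_add_cancel]

variable [RiemannianBundle (fun x : M ↦ TangentSpace I x)]
  [IsContMDiffRiemannianBundle I ∞ E (fun x : M ↦ TangentSpace I x)]

/-- The covariant derivative of the curvature,
`(∇_U R)(X, Y)Z = ∇_U(R(X, Y)Z) - R(∇_U X, Y)Z - R(X, ∇_U Y)Z - R(X, Y)∇_U Z`. -/
noncomputable def nablaRiemann (U X Y Z : Π x : M, TangentSpace I x) : Π x : M, TangentSpace I x :=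
  nabla U (riemann X Y Z) - riemann (nabla U X) Y Z - riemann X (nabla U Y) Z
    - riemann X Y (nabla U Z)

theorem riemann_nabla_sub_riemann_nabla (hX : CMDiffAt ∞ (T% X) x) (hY : CMDiffAt ∞ (T% Y) x)
    (hW : CMDiffAt ∞ (T% W) x) :
    riemann (nabla X Y) Z W x - riemann (nabla Y X) Z W x =
      riemann (VectorField.mlieBracket I X Y) Z W x := by
  have T := isSmoothTensorialAt_riemann_left (Y := Z) hW
  have h1 := contMDiffAt_mlieBracket hX hY
  have h2 := contMDiffAt_nabla hY hX
  rw [T.congr (contMDiffAt_nabla hX hY) (h1.add_section h2) (by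
    simp [← nabla_sub_nabla hX hY]), T.add h1 h2, add_sub_cancel_right]

/-- The second Bianchi identity. -/
theorem nablaRiemann_cyclic (hX : CMDiffAt ∞ (T% X) x) (hY : CMDiffAt ∞ (T% Y) x)
    (hZ : CMDiffAt ∞ (T% Z) x) (hW : CMDiffAt ∞ (T% W) x) :
    nablaRiemann X Y Z W x + nablaRiemann Y Z X W x + nablaRiemann Z X Y W x = 0 := by
  -- Expand `∇_A (R(B, C)W)` and `R(B, C)(∇_A W)` into iterated derivatives of `W`.
  have expand {A B C : Π x : M, TangentSpace I x} (hA : CMDiffAt ∞ (T% A) x)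
      (hB : CMDiffAt ∞ (T% B) x) (hC : CMDiffAt ∞ (T% C) x) :
      nablaRiemann A B C W x = nabla A (nabla B (nabla C W)) x - nabla A (nabla C (nabla B W)) x
        - nabla A (nabla (VectorField.mlieBracket I B C) W) x
        - (nabla B (nabla C (nabla A W)) x - nabla C (nabla B (nabla A W)) x
        - nabla (VectorField.mlieBracket I B C) (nabla A W) x)
        - (riemann (nabla A B) C W x - riemann (nabla A C) B W x) := by
    have h1 := contMDiffAt_nabla hB (contMDiffAt_nabla hC hW)
    have h2 := contMDiffAt_nabla hC (contMDiffAt_nabla hB hW)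
    have h3 := contMDiffAt_nabla (contMDiffAt_mlieBracket hB hC) hW
    have h4 : nabla A (riemann B C W) x = _ := nabla_sub_right (h1.sub_section h2) h3
    rw [nabla_sub_right h1 h2] at h4
    simp only [nablaRiemann, Pi.sub_apply, h4, riemann_swap (X := B) (Y := nabla A C), Pi.neg_apply]
    simp only [riemann, Pi.sub_apply]
    abel
  have hXY := riemann_nabla_sub_riemann_nabla (Z := Z) hX hY hW
  have hYZ := riemann_nabla_sub_riemann_nabla (Z := X) hY hZ hW
  have hZX := riemann_nabla_sub_riemann_nabla (Z := Y) hZ hX hW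
  have J := congrArg (leviCivita W x) (mlieBracket_jacobi hX hY hZ)
  simp only [map_add, map_zero] at J
  have sum_eq : riemann (VectorField.mlieBracket I X Y) Z W x +
      riemann (VectorField.mlieBracket I Y Z) X W x +
      riemann (VectorField.mlieBracket I Z X) Y W x =
      nabla (VectorField.mlieBracket I X Y) (nabla Z W) x
        - nabla Z (nabla (VectorField.mlieBracket I X Y) W) x
        + (nabla (VectorField.mlieBracket I Y Z) (nabla X W) x
        - nabla X (nabla (VectorField.mlieBracket I Y Z) W) x)
        + (nabla (VectorField.mlieBracket I Z X) (nabla Y W) x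
        - nabla Y (nabla (VectorField.mlieBracket I Z X) W) x) := by
    rw [← sub_eq_zero, ← neg_eq_zero, ← J]
    simp only [riemann, Pi.sub_apply]
    change _ = nabla (VectorField.mlieBracket I (VectorField.mlieBracket I X Y) Z) W x +
      nabla (VectorField.mlieBracket I (VectorField.mlieBracket I Y Z) X) W x +
      nabla (VectorField.mlieBracket I (VectorField.mlieBracket I Z X) Y) W x
    abel
  rw [← hXY, ← hYZ, ← hZX] at sum_eq
  rw [expand hX hY hZ, expand hY hZ hX, expand hZ hX hY, ← sub_eq_zero.2 sum_eq.symm]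
  abel

/-- The curvature operator `R(X, Y)` is skew. -/
theorem inner_riemann_skew (hX : CMDiffAt ∞ (T% X) x) (hY : CMDiffAt ∞ (T% Y) x)
    (hZ : CMDiffAt ∞ (T% Z) x) (hW : CMDiffAt ∞ (T% W) x) :
    inner ℝ (riemann X Y Z x) (W x) + inner ℝ (Z x) (riemann X Y W x) = (0 : ℝ) := by
  have key {A B : Π x : M, TangentSpace I x} (hB : CMDiffAt ∞ (T% B) x) :
      d% (fun y ↦ d% (fun y ↦ (inner ℝ (Z y) (W y) : ℝ)) y (B y)) x (A x) =
        inner ℝ (nabla A (nabla B Z) x) (W x) + inner ℝ (nabla B Z x) (nabla A W x) +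
        (inner ℝ (nabla A Z x) (nabla B W x) + inner ℝ (Z x) (nabla A (nabla B W) x)) := by
    have h1 := contMDiffAt_nabla hB hZ
    have h2 := contMDiffAt_nabla hB hW
    rw [← mvfderiv_inner h1 hW, ← mvfderiv_inner hZ h2, ← add_apply,
      ← mvfderiv_fun_add (mdiffAt_fn (contMDiffAt_inner h1 hW))
        (mdiffAt_fn (contMDiffAt_inner hZ h2))]
    congr 1
    refine mvfderiv_congr ?_
    filter_upwards [eventually_mdifferentiableAt_vectorField hZ,
      eventually_mdifferentiableAt_vectorField hW] with y h3 h4 using leviCivita_metric h3 h4 (B y)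
  have h1 := mvfderiv_mlieBracket hX hY (contMDiffAt_inner hZ hW)
  rw [mvfderiv_inner hZ hW, key hX, key hY] at h1
  simp only [riemann, Pi.sub_apply, inner_sub_left, inner_sub_right]
  linarith

theorem nablaRiemann_swap (hX : CMDiffAt ∞ (T% X) x) (hY : CMDiffAt ∞ (T% Y) x)
    (hZ : CMDiffAt ∞ (T% Z) x) : nablaRiemann U X Y Z x = -nablaRiemann U Y X Z x := by
  simp only [nablaRiemann, Pi.sub_apply, riemann_swap (X := X), riemann_swap (X := nabla U X),
    Pi.neg_apply, nabla_neg_right (contMDiffAt_riemann hY hX hZ)]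
  abel

theorem inner_nablaRiemann_skew (hU : CMDiffAt ∞ (T% U) x) (hX : SmoothNear X x)
    (hY : SmoothNear Y x) (hZ : SmoothNear Z x) (hW : SmoothNear W x) :
    inner ℝ (nablaRiemann U X Y Z x) (W x) + inner ℝ (Z x) (nablaRiemann U X Y W x) = (0 : ℝ) := by
  have h0 : d% (fun y ↦ (inner ℝ (riemann X Y Z y) (W y) : ℝ) +
      inner ℝ (Z y) (riemann X Y W y)) x = 0 := by
    rw [mvfderiv_congr (g' := fun _ ↦ 0), mvfderiv_const]
    filter_upwards [hX, hY, hZ, hW] with y h1 h2 h3 h4 using inner_riemann_skew h1 h2 h3 h4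
  replace hX := hX.contMDiffAt
  replace hY := hY.contMDiffAt
  replace hZ := hZ.contMDiffAt
  replace hW := hW.contMDiffAt
  have h1 := contMDiffAt_riemann hX hY hZ
  have h2 := contMDiffAt_riemann hX hY hW
  rw [mvfderiv_fun_add (mdiffAt_fn (contMDiffAt_inner h1 hW))
    (mdiffAt_fn (contMDiffAt_inner hZ h2))] at h0
  replace h0 := congrArg (· (U x)) h0
  simp only [add_apply, zero_apply, mvfderiv_inner h1 hW, mvfderiv_inner hZ h2] at h0
  have k1 := inner_riemann_skew (contMDiffAt_nabla hU hX) hY hZ hW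
  have k2 := inner_riemann_skew hX (contMDiffAt_nabla hU hY) hZ hW
  have k3 := inner_riemann_skew hX hY (contMDiffAt_nabla hU hZ) hW
  have k4 := inner_riemann_skew hX hY hZ (contMDiffAt_nabla hU hW)
  simp only [nablaRiemann, Pi.sub_apply, inner_sub_left, inner_sub_right]
  linarith

/-- The covariant derivative of a `2`-tensor,
`(∇_U T)(X, Y) = U(T(X, Y)) - T(∇_U X, Y) - T(X, ∇_U Y)`. -/
noncomputable def nablaForm (T : Π x : M, TangentSpace I x → TangentSpace I x → ℝ)
    (U X Y : Π x : M, TangentSpace I x) (x : M) : ℝ :=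
  d% (fun y ↦ T y (X y) (Y y)) x (U x) - T x (nabla U X x) (Y x) - T x (X x) (nabla U Y x)

namespace IsOrthonormalFrameAt

variable {e : Fin (Module.finrank ℝ E) → Π x : M, TangentSpace I x}

/-- Taking the Ricci trace commutes with covariant differentiation. -/
theorem nablaForm_ricci (he : IsOrthonormalFrameAt e x) (hU : CMDiffAt ∞ (T% U) x)
    (hX : SmoothNear X x) (hY : SmoothNear Y x) :
    nablaForm ricci U X Y x = ∑ i, inner ℝ (nablaRiemann U (e i) X Y x) (e i x) := by
  have hX' := hX.contMDiffAt
  have hY' := hY.contMDiffAt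
  have hR (i) := contMDiffAt_riemann (he.contMDiffAt i) hX' hY'
  have h1 : d% (fun y ↦ ricci y (X y) (Y y)) x (U x) =
      ∑ i, (inner ℝ (nabla U (riemann (e i) X Y) x) (e i x) +
        inner ℝ (riemann (e i) X Y x) (nabla U (e i) x)) := by
    rw [mvfderiv_congr (g' := fun y ↦ ∑ i, inner ℝ (riemann (e i) X Y y) (e i y)),
      mvfderiv_fun_sum fun i _ ↦ mdiffAt_fn (contMDiffAt_inner (hR i) (he.contMDiffAt i))]
    · rw [sum_apply]
      exact Finset.sum_congr rfl fun i _ ↦ mvfderiv_inner (hR i) (he.contMDiffAt i)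
    · filter_upwards [he.eventually, hX, hY] with y h1 h2 h3 using h1.ricci_apply h2 h3
  have h2 : ∑ i, (inner ℝ (riemann (nabla U (e i)) X Y x) (e i x) +
      inner ℝ (riemann (e i) X Y x) (nabla U (e i) x)) = (0 : ℝ) := by
    have h := he.sum_apply_nabla (curvatureForm (X x) (Y x)) U
    simp only [curvatureForm, LinearMap.mk₂_apply] at h
    simpa only [curvature_apply (contMDiffAt_nabla hU (he.contMDiffAt _)) hX' hY',
      curvature_apply (he.contMDiffAt _) hX' hY'] using h
  rw [nablaForm, h1, he.ricci_apply (contMDiffAt_nabla hU hX') hY',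
    he.ricci_apply hX' (contMDiffAt_nabla hU hY'), ← sub_zero (∑ i, _), ← h2]
  simp only [← Finset.sum_sub_distrib, nablaRiemann, Pi.sub_apply, inner_sub_left]
  exact Finset.sum_congr rfl fun i _ ↦ by ring

/-- Differentiating the scalar curvature is tracing `∇ Ric`. -/
theorem mvfderiv_scalarCurvature (he : IsOrthonormalFrameAt e x) (U : Π x : M, TangentSpace I x) :
    mvfderiv I (scalarCurvature I) x (U x) = ∑ i, nablaForm ricci U (e i) (e i) x := by
  have h2 := he.sum_apply_nabla (ricciForm x) U
  simp only [ricciForm_apply] at h2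
  rw [mvfderiv_congr (g' := fun y ↦ ∑ i, ricci y (e i y) (e i y)),
    mvfderiv_fun_sum fun i _ ↦ mdiffAt_fn (contMDiffAt_ricci (he.smoothNear i) (he.smoothNear i)),
    sum_apply, ← sub_zero (∑ i, _), ← h2, ← Finset.sum_sub_distrib]
  · exact Finset.sum_congr rfl fun i _ ↦ by rw [nablaForm]; ring
  · filter_upwards [he.eventually] with y h1 using h1.scalarCurvature_eq_sum

/-- The contracted Bianchi identity `dR = 2 div Ric`. -/
theorem mvfderiv_scalarCurvature_eq_two_mul (he : IsOrthonormalFrameAt e x)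
    (hZ : SmoothNear Z x) :
    mvfderiv I (scalarCurvature I) x (Z x) = 2 * ∑ i, nablaForm ricci (e i) Z (e i) x := by
  have hZ' := hZ.contMDiffAt
  have he' := he.contMDiffAt
  have key (i j : Fin (Module.finrank ℝ E)) :
      inner ℝ (nablaRiemann Z (e i) (e j) (e j) x) (e i x) =
        inner ℝ (nablaRiemann (e i) (e j) Z (e i) x) (e j x) +
        (inner ℝ (nablaRiemann (e j) (e i) Z (e j) x) (e i x) : ℝ) := by
    have h1 := congrArg (inner ℝ · (e i x)) (nablaRiemann_cyclic hZ' (he' i) (he' j) (he' j))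
    have h2 := inner_nablaRiemann_skew (he' i) (he.smoothNear j) hZ (he.smoothNear j)
      (he.smoothNear i)
    have h3 := nablaRiemann_swap (U := e j) hZ' (he' i) (he' j)
    simp only [inner_add_left, inner_zero_left, h3, inner_neg_left] at h1
    rw [real_inner_comm] at h2
    rw [real_inner_comm] at h2
    rw [real_inner_comm (nablaRiemann (e i) (e j) Z (e i) x)] at h2
    linarith
  rw [he.mvfderiv_scalarCurvature]
  simp only [he.nablaForm_ricci (he' _) hZ (he.smoothNear _),
    he.nablaForm_ricci hZ' (he.smoothNear _) (he.smoothNear _), key, Finset.sum_add_distrib]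
  rw [Finset.sum_comm, two_mul]

end IsOrthonormalFrameAt

end Bianchi

/-! ### The divergence of the soliton equation -/

section Divergence

variable {E : Type*} [NormedAddCommGroup E] [NormedSpace ℝ E] [FiniteDimensional ℝ E]
  {H : Type*} [TopologicalSpace H] {I : ModelWithCorners ℝ E H}
  {M : Type*} [TopologicalSpace M] [ChartedSpace H M] [IsManifold I ∞ M]
  [RiemannianBundle (fun x : M ↦ TangentSpace I x)]
  [IsContMDiffRiemannianBundle I ∞ E (fun x : M ↦ TangentSpace I x)]

variable {U X Y Z V : Π x : M, TangentSpace I x} {g : M → ℝ} {x : M}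

theorem smoothNear_extend (v : TangentSpace I x) :
    SmoothNear (extend E v : Π y : M, TangentSpace I y) x := by
  obtain ⟨s, hs, h⟩ := exists_contMDiffOn_extend (k := ∞) I E v
  filter_upwards [eventually_mem_nhds_iff.2 hs] with y hy
  exact (h y (mem_of_mem_nhds hy)).contMDiffAt hy

theorem lieDerivMetric_apply_nabla (hV : MDiffAt (T% V) x) :
    lieDerivMetric V x (X x) (Y x) =
      inner ℝ (nabla X V x) (Y x) + inner ℝ (X x) (nabla Y V x) :=
  lieDerivMetric_eq_leviCivita hV _ _

theorem lieDerivMetric_comm (hV : MDiffAt (T% V) x) (u w : TangentSpace I x) :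
    lieDerivMetric V x u w = lieDerivMetric V x w u := by
  rw [lieDerivMetric_eq_leviCivita hV, lieDerivMetric_eq_leviCivita hV, add_comm,
    real_inner_comm, real_inner_comm w]

/-- The metric is parallel. -/
theorem nablaForm_inner (hX : CMDiffAt ∞ (T% X) x) (hY : CMDiffAt ∞ (T% Y) x) :
    nablaForm (fun y (u w : TangentSpace I y) ↦ inner ℝ u w) U X Y x = 0 := by
  rw [nablaForm, mvfderiv_inner hX hY]
  ring

theorem contMDiffAt_lieDerivMetric (hV : CMDiffAt ∞ (T% V) x) (hX : CMDiffAt ∞ (T% X) x)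
    (hY : CMDiffAt ∞ (T% Y) x) :
    ContMDiffAt I 𝓘(ℝ, ℝ) ∞ (fun y ↦ lieDerivMetric V y (X y) (Y y)) x := by
  refine ((contMDiffAt_inner (contMDiffAt_nabla hX hV) hY).add
    (contMDiffAt_inner hX (contMDiffAt_nabla hY hV))).congr_of_eventuallyEq ?_
  filter_upwards [eventually_mdifferentiableAt_vectorField hV] with y h
    using lieDerivMetric_apply_nabla h

theorem nablaForm_lieDerivMetric (hV : CMDiffAt ∞ (T% V) x)
    (hX : CMDiffAt ∞ (T% X) x) (hY : CMDiffAt ∞ (T% Y) x) :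
    nablaForm (lieDerivMetric V) U X Y x =
      inner ℝ (nabla₂ U X V x) (Y x) + inner ℝ (X x) (nabla₂ U Y V x) := by
  have h1 := contMDiffAt_nabla hX hV
  have h2 := contMDiffAt_nabla hY hV
  have h3 : d% (fun y ↦ lieDerivMetric V y (X y) (Y y)) x (U x) =
      inner ℝ (nabla U (nabla X V) x) (Y x) + inner ℝ (nabla X V x) (nabla U Y x) +
      (inner ℝ (nabla U X x) (nabla Y V x) + inner ℝ (X x) (nabla U (nabla Y V) x)) := by
    rw [← mvfderiv_inner h1 hY, ← mvfderiv_inner hX h2, ← add_apply,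
      ← mvfderiv_fun_add (mdiffAt_fn (contMDiffAt_inner h1 hY))
        (mdiffAt_fn (contMDiffAt_inner hX h2))]
    congr 1
    refine mvfderiv_congr ?_
    filter_upwards [eventually_mdifferentiableAt_vectorField hV] with y h
      using lieDerivMetric_apply_nabla h
  rw [nablaForm, h3, lieDerivMetric_apply_nabla (mdiffAt_vf hV),
    lieDerivMetric_apply_nabla (mdiffAt_vf hV)]
  simp only [nabla₂, Pi.sub_apply, inner_sub_left, inner_sub_right]
  ring

/-- The third covariant derivative of a function is symmetric in the last two arguments. -/
theorem inner_nabla₂_grad_comm (hg : ContMDiff I 𝓘(ℝ, ℝ) ∞ g) (hU : CMDiffAt ∞ (T% U) x)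
    (hX : SmoothNear X x) (hY : SmoothNear Y x) :
    inner ℝ (nabla₂ U X (grad I g) x) (Y x) = inner ℝ (nabla₂ U Y (grad I g) x) (X x) := by
  have hG := contMDiffAt_grad (hg x)
  have h0 : d% (fun y ↦ (inner ℝ (nabla X (grad I g) y) (Y y) : ℝ)) x =
      d% (fun y ↦ (inner ℝ (nabla Y (grad I g) y) (X y) : ℝ)) x := by
    refine mvfderiv_congr ?_
    filter_upwards [hX, hY] with y h1 h2 using inner_nabla_grad_comm (hg y) h1 h2
  replace hX := hX.contMDiffAt
  replace hY := hY.contMDiffAt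
  replace h0 := congrArg (· (U x)) h0
  simp only [mvfderiv_inner (contMDiffAt_nabla hX hG) hY,
    mvfderiv_inner (contMDiffAt_nabla hY hG) hX] at h0
  have k1 := inner_nabla_grad_comm (hg x) (contMDiffAt_nabla hU hX) hY
  have k2 := inner_nabla_grad_comm (hg x) (contMDiffAt_nabla hU hY) hX
  simp only [nabla₂, Pi.sub_apply, inner_sub_left]
  linarith

namespace IsOrthonormalFrameAt

variable {e : Fin (Module.finrank ℝ E) → Π x : M, TangentSpace I x}

theorem mvfderiv_divergence (he : IsOrthonormalFrameAt e x) (hV : CMDiffAt ∞ (T% V) x) :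
    d% (divergence V) x (U x) = ∑ i, inner ℝ (nabla₂ U (e i) V x) (e i x) := by
  have he' := he.contMDiffAt
  -- The trace of `∇V` in the moving frame; the terms with `∇_U e_i` cancel.
  let B : TangentSpace I x →ₗ[ℝ] TangentSpace I x →ₗ[ℝ] ℝ :=
    LinearMap.mk₂ ℝ (fun u u' ↦ inner ℝ (leviCivita V x u) u')
      (fun _ _ _ ↦ by rw [map_add, inner_add_left])
      (fun _ _ _ ↦ by rw [map_smul, real_inner_smul_left, smul_eq_mul])
      (fun _ _ _ ↦ inner_add_right _ _ _)
      (fun _ _ _ ↦ by rw [real_inner_smul_right, smul_eq_mul])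
  have h2 := he.sum_apply_nabla B U
  simp only [B, LinearMap.mk₂_apply] at h2
  rw [mvfderiv_congr (g' := fun y ↦ ∑ i, inner ℝ (nabla (e i) V y) (e i y)),
    mvfderiv_fun_sum fun i _ ↦
      mdiffAt_fn (contMDiffAt_inner (contMDiffAt_nabla (he' i) hV) (he' i)),
    sum_apply, ← sub_zero (∑ i, _), ← h2, ← Finset.sum_sub_distrib]
  · refine Finset.sum_congr rfl fun i _ ↦ ?_
    rw [mvfderiv_inner (contMDiffAt_nabla (he' i) hV) (he' i)]
    simp only [nabla₂, Pi.sub_apply, inner_sub_left, nabla]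
    ring
  · filter_upwards [he.eventually] with y h1 using h1.divergence_eq_sum V

/-- Commuting covariant derivatives in `tr (u ↦ ∇²_{u, Z} V)` produces the Ricci tensor. -/
theorem sum_inner_nabla₂ (he : IsOrthonormalFrameAt e x) (hZ : CMDiffAt ∞ (T% Z) x)
    (hV : CMDiffAt ∞ (T% V) x) :
    ∑ i, inner ℝ (nabla₂ (e i) Z V x) (e i x) =
      ricci x (Z x) (V x) + d% (divergence V) x (Z x) := by
  rw [he.mvfderiv_divergence hV, he.ricci_apply hZ hV, ← Finset.sum_add_distrib]
  refine Finset.sum_congr rfl fun i _ ↦ ?_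
  rw [← nabla₂_sub_nabla₂ (he.contMDiffAt i) hZ, ← inner_add_left, sub_add_cancel]

/-- The divergence of `L_V g`. -/
theorem sum_nablaForm_lieDerivMetric (he : IsOrthonormalFrameAt e x) (hZ : CMDiffAt ∞ (T% Z) x)
    (hV : CMDiffAt ∞ (T% V) x) :
    ∑ i, nablaForm (lieDerivMetric V) (e i) Z (e i) x =
      ricci x (Z x) (V x) + d% (divergence V) x (Z x) + inner ℝ (Z x) (roughLaplacian V x) := by
  simp only [nablaForm_lieDerivMetric hV hZ (he.contMDiffAt _),
    Finset.sum_add_distrib, he.sum_inner_nabla₂ hZ hV, he.roughLaplacian_eq_sum hV, inner_sum]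

/-- The Bochner formula `Δ∇g = ∇Δg + Ric(∇g)`. -/
theorem inner_roughLaplacian_grad (he : IsOrthonormalFrameAt e x) (hZ : SmoothNear Z x)
    (hg : ContMDiff I 𝓘(ℝ, ℝ) ∞ g) :
    inner ℝ (Z x) (roughLaplacian (grad I g) x) =
      ricci x (Z x) (grad I g x) + mvfderiv I (laplacian I g) x (Z x) := by
  have hG := contMDiffAt_grad (hg x)
  have h := he.sum_inner_nabla₂ hZ.contMDiffAt hG
  rw [he.roughLaplacian_eq_sum hG, inner_sum]
  refine Eq.trans (Finset.sum_congr rfl fun i _ ↦ ?_) h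
  rw [inner_nabla₂_grad_comm hg (he.contMDiffAt i) hZ (he.smoothNear i), real_inner_comm]

end IsOrthonormalFrameAt

end Divergence

section Soliton

variable {E : Type*} [NormedAddCommGroup E] [NormedSpace ℝ E] [FiniteDimensional ℝ E]
  {H : Type*} [TopologicalSpace H] {I : ModelWithCorners ℝ E H}
  {M : Type*} [TopologicalSpace M] [ChartedSpace H M] [IsManifold I ∞ M]
  [RiemannianBundle (fun x : M ↦ TangentSpace I x)]
  [IsContMDiffRiemannianBundle I ∞ E (fun x : M ↦ TangentSpace I x)]
  {f : M → ℝ} {V : Π x : M, TangentSpace I x}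

/-- The divergence of the soliton equation. -/
theorem mvfderiv_scalarCurvature_sub_eq (hf : ContMDiff I 𝓘(ℝ, ℝ) ∞ f)
    (hV : CMDiff ∞ (T% V))
    (hsol : ∀ (x : M) (u w : TangentSpace I x),
      2 * ricci x u w + inner ℝ u w - lieDerivMetric (grad I f) x u w = lieDerivMetric V x u w)
    (x : M) (w : TangentSpace I x) :
    mvfderiv I (scalarCurvature I) x w - 2 * ricci x w (grad I f x) -
        2 * mvfderiv I (laplacian I f) x w =
      ricci x w (V x) + mvfderiv I (divergence V) x w + inner ℝ w (roughLaplacian V x) := by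
  obtain ⟨e, he⟩ := exists_isOrthonormalFrameAt (I := I) x
  let Z : Π y : M, TangentSpace I y := extend E w
  have hZn : SmoothNear Z x := smoothNear_extend w
  have hZ := hZn.contMDiffAt
  have hZw : Z x = w := extend_apply_self ..
  have hG := contMDiffAt_grad (hf x)
  have he' := he.contMDiffAt
  have key (i) : nablaForm (lieDerivMetric V) (e i) Z (e i) x =
      2 * nablaForm ricci (e i) Z (e i) x
        - nablaForm (lieDerivMetric (grad I f)) (e i) Z (e i) x := by
    have h0 := nablaForm_inner (U := e i) hZ (he' i)
    have d1 := mdiffAt_fn (contMDiffAt_ricci hZn (he.smoothNear i))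
    have d2 := mdiffAt_fn (contMDiffAt_inner hZ (he' i))
    have d3 := mdiffAt_fn (contMDiffAt_lieDerivMetric hG hZ (he' i))
    have d4 : MDiffAt (fun y ↦ 2 * ricci y (Z y) (e i y)) x := mdifferentiableAt_const.mul d1
    have h1 : d% (fun y ↦ lieDerivMetric V y (Z y) (e i y)) x =
        2 • d% (fun y ↦ ricci y (Z y) (e i y)) x + d% (fun y ↦ (inner ℝ (Z y) (e i y) : ℝ)) x
          - d% (fun y ↦ lieDerivMetric (grad I f) y (Z y) (e i y)) x := by
      simp only [← hsol]
      have d5 : MDiffAt (fun y ↦ 2 * ricci y (Z y) (e i y) + inner ℝ (Z y) (e i y)) x := d4.add d2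
      rw [mvfderiv_fun_sub d5 d3, mvfderiv_fun_add d4 d2,
        mvfderiv_fun_mul mdifferentiableAt_const d1, mvfderiv_const]
      ext u
      simp
    rw [nablaForm] at h0
    rw [nablaForm, h1, ← hsol, ← hsol, nablaForm, nablaForm]
    simp only [sub_apply, add_apply, smul_apply, nsmul_eq_mul, Nat.cast_ofNat]
    linarith
  have h1 := he.sum_nablaForm_lieDerivMetric hZ (hV x)
  have h2 := he.sum_nablaForm_lieDerivMetric hZ hG
  have h3 := he.inner_roughLaplacian_grad hZn hf
  have h4 := he.mvfderiv_scalarCurvature_eq_two_mul hZn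
  simp only [key, Finset.sum_sub_distrib, ← Finset.mul_sum] at h1
  rw [hZw] at h1 h2 h3 h4
  change _ = _ + mvfderiv I (laplacian I f) x w + _ at h2
  linarith

/-- All other terms of the soliton equation are symmetric, hence so is the Ricci tensor. -/
theorem ricci_comm_of_soliton (hf : ContMDiff I 𝓘(ℝ, ℝ) ∞ f) (hV : CMDiff ∞ (T% V))
    (hsol : ∀ (x : M) (u w : TangentSpace I x),
      2 * ricci x u w + inner ℝ u w - lieDerivMetric (grad I f) x u w = lieDerivMetric V x u w)
    (x : M) (u w : TangentSpace I x) : ricci x u w = ricci x w u := by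
  have h1 := hsol x u w
  have h2 := hsol x w u
  rw [lieDerivMetric_comm (mdiffAt_vf (hV x)) w, lieDerivMetric_comm
    (mdiffAt_vf (contMDiffAt_grad (hf x))) w, real_inner_comm] at h2
  linarith

theorem inner_bakryEmeryVector (x : M) (v w : TangentSpace I x) :
    inner ℝ (bakryEmeryVector f x v) w = bakryEmery f x v w := by
  have h (u : TangentSpace I x) : bakryEmery f x v u =
      ricciForm x v u - inner ℝ (leviCivita (grad I f) x v) u := rfl
  conv_rhs => rw [← (stdOrthonormalBasis ℝ (TangentSpace I x)).sum_repr' w]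
  simp only [bakryEmeryVector, sum_inner, real_inner_smul_left, h, map_sum, map_smul, inner_sum,
    real_inner_smul_right, smul_eq_mul, ← Finset.sum_sub_distrib]
  exact Finset.sum_congr rfl fun i _ ↦ by ring

theorem hessian_comm (hf : ContMDiff I 𝓘(ℝ, ℝ) ∞ f) (x : M) (u w : TangentSpace I x) :
    (inner ℝ (leviCivita (grad I f) x u) w : ℝ) = inner ℝ (leviCivita (grad I f) x w) u := by
  simpa [nabla] using
    inner_nabla_grad_comm (hf x) (contMDiffAt_extend_infty u) (contMDiffAt_extend_infty w)

theorem contMDiffAt_laplacian (hf : ContMDiff I 𝓘(ℝ, ℝ) ∞ f) (x : M) :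
    ContMDiffAt I 𝓘(ℝ, ℝ) ∞ (laplacian I f) x :=
  contMDiffAt_divergence (contMDiffAt_grad (hf x))

/-- The divergence of the soliton equation, added to that equation with `∇f` in one slot. -/
theorem weightedLaplacian_add_bakryEmeryVector_add_grad (hf : ContMDiff I 𝓘(ℝ, ℝ) ∞ f)
    (hV : CMDiff ∞ (T% V))
    (hsol : ∀ (x : M) (u w : TangentSpace I x),
      2 * ricci x u w + inner ℝ u w - lieDerivMetric (grad I f) x u w = lieDerivMetric V x u w)
    (x : M) :
    weightedLaplacian f V x + bakryEmeryVector f x (V x) + grad I (weightedDivergence f V) x =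
      grad I (fun y ↦ scalarCurvature I y + f y - 2 * laplacian I f y - ‖grad I f y‖ ^ 2) x := by
  refine ext_inner_right ℝ fun w ↦ ?_
  have hG := contMDiffAt_grad (hf x)
  have dR := mdiffAt_fn (contMDiffAt_scalarCurvature (I := I) x)
  have df := mdiffAt_fn (hf x)
  have dL := mdiffAt_fn (contMDiffAt_laplacian hf x)
  have dL2 : MDiffAt (fun y ↦ 2 * laplacian I f y) x := mdifferentiableAt_const.mul dL
  have dG := mdiffAt_fn (contMDiffAt_inner hG hG)
  have dV := mdiffAt_fn (contMDiffAt_divergence (hV x))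
  have dGV := mdiffAt_fn (contMDiffAt_inner hG (hV x))
  have h1 : mvfderiv I (weightedDivergence f V) x w = mvfderiv I (divergence V) x w +
      (inner ℝ (leviCivita (grad I f) x w) (V x) + inner ℝ (grad I f x) (leviCivita V x w)) := by
    rw [← leviCivita_metric (mdiffAt_vf hG) (mdiffAt_vf (hV x)), ← add_apply,
      ← mvfderiv_fun_add dV dGV]
    rfl
  have h2 : mvfderiv I (fun y ↦ scalarCurvature I y + f y - 2 * laplacian I f y
      - ‖grad I f y‖ ^ 2) x w = mvfderiv I (scalarCurvature I) x w + d% f x w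
      - 2 * mvfderiv I (laplacian I f) x w
      - 2 * inner ℝ (leviCivita (grad I f) x w) (grad I f x) := by
    simp only [← real_inner_self_eq_norm_sq]
    have d1 : MDiffAt (fun y ↦ scalarCurvature I y + f y) x := dR.add df
    have d2 : MDiffAt (fun y ↦ scalarCurvature I y + f y - 2 * laplacian I f y) x := d1.sub dL2
    rw [mvfderiv_fun_sub d2 dG, mvfderiv_fun_sub d1 dL2,
      mvfderiv_fun_add dR df, mvfderiv_fun_mul mdifferentiableAt_const dL, mvfderiv_const]
    simp only [sub_apply, add_apply, leviCivita_metric (mdiffAt_vf hG) (mdiffAt_vf hG),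
      smul_apply, smul_eq_mul, smul_zero, add_zero]
    rw [real_inner_comm (leviCivita (grad I f) x w) (grad I f x)]
    ring
  have h3 := mvfderiv_scalarCurvature_sub_eq hf hV hsol x w
  have h4 := hsol x w (grad I f x)
  rw [lieDerivMetric_eq_leviCivita (mdiffAt_vf hG),
    lieDerivMetric_eq_leviCivita (mdiffAt_vf (hV x))] at h4
  have h5 : (inner ℝ w (grad I f x) : ℝ) = d% f x w := by rw [real_inner_comm, inner_grad]
  have h6 := hessian_comm hf x w (grad I f x)
  have h7 := hessian_comm hf x w (V x)
  have h8 := ricci_comm_of_soliton hf hV hsol x w (V x)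
  rw [real_inner_comm (leviCivita (grad I f) x (grad I f x)) w,
    real_inner_comm (leviCivita V x (grad I f x)) w, h5] at h4
  rw [real_inner_comm (roughLaplacian V x) w] at h3
  have h9 : (inner ℝ (leviCivita V x w) (grad I f x) : ℝ) = d% f x (leviCivita V x w) := by
    rw [real_inner_comm, inner_grad]
  simp only [inner_add_left, inner_grad, inner_bakryEmeryVector, weightedLaplacian, h1, h2,
    bakryEmery, hessian]
  linarith

end Soliton

/-! ### The maximum principle -/

section MaximumPrinciple

variable {E : Type*} [NormedAddCommGroup E] [NormedSpace ℝ E] [FiniteDimensional ℝ E]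
  {H : Type*} [TopologicalSpace H] {I : ModelWithCorners ℝ E H}
  {M : Type*} [TopologicalSpace M] [ChartedSpace H M] [IsManifold I ∞ M]
  [BoundarylessManifold I M]

variable {U V : Π x : M, TangentSpace I x} {f g : M → ℝ} {x : M}

/-- The derivative of `g` along integral curves of `U` is `Ug`. -/
theorem hasDerivAt_comp_integralCurve {γ : ℝ → M} {t : ℝ}
    (hγ : HasMFDerivAt 𝓘(ℝ, ℝ) I γ t ((1 : ℝ →L[ℝ] ℝ).smulRight (U (γ t))))
    (hg : MDiffAt g (γ t)) : HasDerivAt (g ∘ γ) (d% g (γ t) (U (γ t))) t := by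
  have h : HasFDerivAt (g ∘ γ) ((mvfderiv I g (γ t)).comp
      ((1 : ℝ →L[ℝ] ℝ).smulRight (U (γ t)))) t := (hg.hasMFDerivAt.comp t hγ).hasFDerivAt
  simpa using h.hasDerivAt

/-- First and second derivative test along the integral curve of `U` through a maximum. -/
theorem derivative_test_of_isLocalMax (hU : CMDiffAt ∞ (T% U) x)
    (hg : ContMDiffAt I 𝓘(ℝ, ℝ) ∞ g x) (hmax : IsLocalMax g x) :
    d% g x (U x) = 0 ∧ d% (fun y ↦ d% g y (U y)) x (U x) ≤ 0 := by
  have : CompleteSpace E := FiniteDimensional.complete ℝ E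
  have := isManifold_one_of_infty (I := I) (M := M)
  obtain ⟨γ, hγ0, hγ⟩ := exists_isMIntegralCurveAt_of_contMDiffAt_boundaryless (t₀ := 0)
    (hU.of_le (n := ∞) (m := 1) (mod_cast le_top))
  have hcont : ContinuousAt γ 0 := hγ.self_of_nhds.continuousAt
  have hlim : Tendsto γ (𝓝 0) (𝓝 x) := hγ0 ▸ hcont
  have hmax' : IsLocalMax (g ∘ γ) 0 := by
    have h : ∀ᶠ t in 𝓝 0, g (γ t) ≤ g x := hlim.eventually hmax
    simpa only [IsLocalMax, IsMaxFilter, Function.comp, hγ0] using h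
  have h1 : ∀ᶠ t in 𝓝 0, HasDerivAt (g ∘ γ) (d% g (γ t) (U (γ t))) t := by
    filter_upwards [hγ, hlim.eventually (eventually_mdifferentiableAt_function hg)] with t h1 h2
      using hasDerivAt_comp_integralCurve h1 h2
  have h2 : HasDerivAt (fun t ↦ d% g (γ t) (U (γ t))) (d% (fun y ↦ d% g y (U y)) x (U x)) 0 := by
    have h := hasDerivAt_comp_integralCurve (g := fun y ↦ d% g y (U y)) hγ.self_of_nhds
      (by rw [hγ0]; exact mdiffAt_fn (contMDiffAt_mvfderiv_apply hg hU))
    rw [hγ0] at h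
    exact h
  have h3 : deriv (g ∘ γ) =ᶠ[𝓝 0] fun t ↦ d% g (γ t) (U (γ t)) := h1.mono fun t ht ↦ ht.deriv
  have h4 : deriv (deriv (g ∘ γ)) 0 = d% (fun y ↦ d% g y (U y)) x (U x) := by
    rw [h3.deriv_eq, h2.deriv]
  constructor
  · rw [← hγ0, ← h1.self_of_nhds.deriv, hmax'.deriv_eq_zero]
  · -- A positive second derivative makes `0` a local minimum too, so `g ∘ γ` is locally constant.
    by_contra! hpos
    rw [← h4] at hpos
    have hmin := isLocalMin_of_deriv_deriv_pos hpos hmax'.deriv_eq_zero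
      h1.self_of_nhds.continuousAt
    have hconst : g ∘ γ =ᶠ[𝓝 0] fun _ ↦ (g ∘ γ) 0 := by
      filter_upwards [hmax', hmin] with t h5 h6 using le_antisymm h5 h6
    rw [hconst.deriv.deriv_eq] at hpos
    simp at hpos

variable [RiemannianBundle (fun x : M ↦ TangentSpace I x)]
  [IsContMDiffRiemannianBundle I ∞ E (fun x : M ↦ TangentSpace I x)]

/-- The maximum principle for `|V|²`, by means of `½Δ_f|V|² = ⟨Δ_f V, V⟩ + |∇V|²`. -/
theorem inner_weightedLaplacian_self_nonpos (hV : CMDiffAt ∞ (T% V) x)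
    (hmax : IsLocalMax (fun y ↦ ‖V y‖) x) (f : M → ℝ) :
    inner ℝ (weightedLaplacian f V x) (V x) ≤ (0 : ℝ) := by
  obtain ⟨e, he⟩ := exists_isOrthonormalFrameAt (I := I) x
  have hφ := contMDiffAt_inner hV hV
  have hmax' : IsLocalMax (fun y ↦ (inner ℝ (V y) (V y) : ℝ)) x := by
    filter_upwards [hmax] with y hy
    simp only [real_inner_self_eq_norm_sq]
    gcongr
  have first (w : TangentSpace I x) : inner ℝ (leviCivita V x w) (V x) = (0 : ℝ) := by
    have h := (derivative_test_of_isLocalMax (contMDiffAt_extend_infty w) hφ hmax').1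
    rw [mvfderiv_inner hV hV, real_inner_comm (nabla _ V x) (V x), nabla, extend_apply_self] at h
    linarith
  have second (i) : inner ℝ (nabla (e i) (nabla (e i) V) x) (V x) ≤ (0 : ℝ) := by
    have hi := contMDiffAt_nabla (he.contMDiffAt i) hV
    have h := (derivative_test_of_isLocalMax (he.contMDiffAt i) hφ hmax').2
    rw [mvfderiv_congr (g' := fun y ↦ (inner ℝ (nabla (e i) V y) (V y) : ℝ) +
        inner ℝ (nabla (e i) V y) (V y)),
      mvfderiv_fun_add (mdiffAt_fn (contMDiffAt_inner hi hV))
        (mdiffAt_fn (contMDiffAt_inner hi hV)), add_apply, mvfderiv_inner hi hV] at h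
    · have h2 := real_inner_self_nonneg (x := nabla (e i) V x)
      linarith
    · filter_upwards [eventually_mdifferentiableAt_vectorField hV] with y hy
      rw [leviCivita_metric hy hy, real_inner_comm (leviCivita V y (e i y)) (V y)]
      rfl
  rw [weightedLaplacian, inner_add_left, first, add_zero, he.roughLaplacian_eq_sum hV, sum_inner]
  refine Finset.sum_nonpos fun i _ ↦ ?_
  have h3 := first (nabla (e i) (e i) x)
  have h4 := second i
  rw [nabla₂, Pi.sub_apply, inner_sub_left]
  change _ - inner ℝ (leviCivita V x (nabla (e i) (e i) x)) (V x) ≤ _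
  linarith

theorem continuous_norm_of_contMDiff (hV : CMDiff ∞ (T% V)) : Continuous fun y ↦ ‖V y‖ := by
  have h : Continuous fun y ↦ (inner ℝ (V y) (V y) : ℝ) :=
    continuous_iff_continuousAt.2 fun x ↦ (contMDiffAt_inner (hV x) (hV x)).continuousAt
  simpa [real_inner_self_eq_norm_sq, Real.sqrt_sq (norm_nonneg _)] using h.sqrt

/-- A vector field in the kernel of `Δ_f + Ric_f` which tends to `0` at infinity vanishes if
`Ric_f` is negative definite. -/
theorem eq_zero_of_weightedLaplacian_add_bakryEmeryVector (hV : CMDiff ∞ (T% V))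
    (hlim : Tendsto (fun x ↦ ‖V x‖) (cocompact M) (𝓝 0))
    (hneg : ∀ (x : M) (u : TangentSpace I x), u ≠ 0 → bakryEmery f x u u < 0)
    (h : ∀ x, weightedLaplacian f V x + bakryEmeryVector f x (V x) = 0) (x : M) : V x = 0 := by
  by_contra hx
  obtain ⟨p, hp⟩ := (continuous_norm_of_contMDiff hV).exists_forall_ge' x
    ((hlim.eventually_lt_const (norm_pos_iff.2 hx)).mono fun _ ↦ le_of_lt)
  have hVp : V p ≠ 0 := norm_pos_iff.1 ((norm_pos_iff.2 hx).trans_le (hp x))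
  have h1 := inner_weightedLaplacian_self_nonpos (hV p) (Eventually.of_forall hp) f
  have h2 := congrArg (inner ℝ · (V p)) (h p)
  simp only [inner_add_left, inner_zero_left, inner_bakryEmeryVector] at h2
  linarith [hneg p (V p) hVp]

theorem grad_weightedDivergence_eq_of_sub_eq_const {c : ℝ}
    (hf : ContMDiffAt I 𝓘(ℝ, ℝ) ∞ f x) (hV : CMDiffAt ∞ (T% V) x)
    (hc : ∀ y, g y - weightedDivergence f V y = c) :
    grad I (weightedDivergence f V) x = grad I g x := by
  have h1 : MDiffAt (weightedDivergence f V) x :=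
    (mdiffAt_fn (contMDiffAt_divergence hV)).add
      (mdiffAt_fn (contMDiffAt_inner (contMDiffAt_grad hf) hV))
  have h2 : g = fun y ↦ weightedDivergence f V y + c := by
    funext y
    rw [← hc y]
    ring
  rw [h2, grad, grad, mvfderiv_fun_add h1 mdifferentiableAt_const, mvfderiv_const, add_zero]

end MaximumPrinciple

end RiemGeom

theorem proposition4p1 {n : ℕ} {M : Type*} [TopologicalSpace M] [T2Space M]
    [SecondCountableTopology M] [ChartedSpace (EuclideanSpace ℝ (Fin n)) M] [IsManifold (𝓡 n) ∞ M]
    [RiemannianBundle (fun x : M ↦ TangentSpace (𝓡 n) x)]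
    [IsContMDiffRiemannianBundle (𝓡 n) ∞ (EuclideanSpace ℝ (Fin n))
      (fun x : M ↦ TangentSpace (𝓡 n) x)]
    (f : M → ℝ) (hf : ContMDiff (𝓡 n) 𝓘(ℝ, ℝ) ∞ f)
    (V : Π x : M, TangentSpace (𝓡 n) x)
    (hV : ContMDiff (𝓡 n) (𝓡 n).tangent ∞ (fun x ↦ (⟨x, V x⟩ : TangentBundle (𝓡 n) M)))
    (hsol : ∀ (x : M) (u w : TangentSpace (𝓡 n) x),
      2 * RiemGeom.ricci x u w + inner ℝ u w
        - RiemGeom.lieDerivMetric (RiemGeom.grad (𝓡 n) f) x u w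
        = RiemGeom.lieDerivMetric V x u w) :
    (∀ x : M, RiemGeom.weightedLaplacian f V x + RiemGeom.bakryEmeryVector f x (V x)
        + RiemGeom.grad (𝓡 n) (RiemGeom.weightedDivergence f V) x
        = RiemGeom.grad (𝓡 n) (fun y ↦ RiemGeom.scalarCurvature (𝓡 n) y + f y
            - 2 * RiemGeom.laplacian (𝓡 n) f y - ‖RiemGeom.grad (𝓡 n) f y‖ ^ 2) x) ∧
    (Tendsto (fun x ↦ ‖V x‖) (cocompact M) (𝓝 0) →
      (∀ (x : M) (u : TangentSpace (𝓡 n) x), u ≠ 0 → RiemGeom.bakryEmery f x u u < 0) →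
      (((∃ c : ℝ, ∀ x : M, RiemGeom.scalarCurvature (𝓡 n) x + f x
            - 2 * RiemGeom.laplacian (𝓡 n) f x - ‖RiemGeom.grad (𝓡 n) f x‖ ^ 2 = c) ∧
          ∀ x : M, RiemGeom.weightedDivergence f V x = 0) ∨
        ∃ c : ℝ, ∀ x : M, RiemGeom.scalarCurvature (𝓡 n) x + f x
            - 2 * RiemGeom.laplacian (𝓡 n) f x - ‖RiemGeom.grad (𝓡 n) f x‖ ^ 2
            - RiemGeom.weightedDivergence f V x = c) →
      ∀ x : M, V x = 0) := by
  have key := RiemGeom.weightedLaplacian_add_bakryEmeryVector_add_grad hf hV hsol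
  refine ⟨key, fun hlim hneg hconst ↦ ?_⟩
  -- The first alternative is a special case of the second.
  obtain ⟨c, hc⟩ : ∃ c : ℝ, ∀ x : M, RiemGeom.scalarCurvature (𝓡 n) x + f x
      - 2 * RiemGeom.laplacian (𝓡 n) f x - ‖RiemGeom.grad (𝓡 n) f x‖ ^ 2
      - RiemGeom.weightedDivergence f V x = c := by
    rcases hconst with ⟨⟨c, hc⟩, hdiv⟩ | h
    · exact ⟨c, fun x ↦ by rw [hdiv, sub_zero, hc]⟩
    · exact h
  refine RiemGeom.eq_zero_of_weightedLaplacian_add_bakryEmeryVector hV hlim hneg fun x ↦ ?_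
  have hx := key x
  rwa [RiemGeom.grad_weightedDivergence_eq_of_sub_eq_const (hf x) (hV x) hc,
    add_eq_right] at hx
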